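/- Let $k$ be a commutative ring, $R$ a $k$-algebra, $\bar R=R^{\mathrm{op}}$ and $R^e=R\otimes_k\bar R$; left $R^e$-modules are identified with ($k$-central) $R$-bimodules, and form a monoidal category under $\otimes_R$. A $\times_R$-bialgebra (left bialgebroid over $R$) is a $k$-algebra $H$ with $k$-algebra maps $s\colon R\to H$ and $t\colon\bar R\to H$ with commuting images (that is, a $k$-algebra map $R^e\to H$), a coassociative comultiplication $\Delta(h)=\sum h_1\otimes h_2\in H\otimes_R H$ (where $t(r)g\otimes h=g\otimes s(r)h$) and a counit $\varepsilon\colon H\to R$, which are $R$-bimodule maps for $r\cdot h\cdot r'=s(r)t(r')h$, such that $\sum s(\varepsilon(h_1))h_2=h=\sum t(\varepsilon(h_2))h_1$, $\sum h_1t(r)\otimes h_2=\sum h_1\otimes h_2s(r)$, $\Delta(1)=1\otimes1$, $\Delta(gh)=\Delta(g)\Delta(h)$, $\varepsilon(1)=1$ and $\varepsilon(g\,s(\varepsilon(h)))=\varepsilon(gh)=\varepsilon(g\,t(\varepsilon(h)))$. Then the category of left $H$-modules is monoidal, with $M\otimes_R N$ (where $t(r)m\otimes n=m\otimes s(r)n$)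 and $h(m\otimes n)=\sum h_1m\otimes h_2n$, and the underlying functor to left $R^e$-modules is strict monoidal. In a monoidal category, a right inner hom-functor $\hom_r(X,-)$ is a right adjoint of $-\otimes X$. The $\times_R$-bialgebra $H$ is a $\times_R$-Hopf algebra if the underlying functor from left $H$-modules to left $R^e$-modules preserves right inner hom-functors. It is a $\times_R$-anti-Hopf algebra if its coopposite (the $\times_{\bar R}$-bialgebra obtained by interchanging $s$ with $t$ and the two tensor factors of $\Delta$) is a $\times_{\bar R}$-Hopf algebra. It is left finite if it is finitely generated projective as a left $\bar R$-module, via $t$ and left multiplication. If $H$ is left finite, its left skew dual is the $\times_R$-bialgebra $$H^\vee=\operatorname{Hom}_{\bar R-}(H,R)=\{\varphi\colon H\to R \text{ additive}\mid \varphi(t(r)h)=\varphi(h)r \text{ for all } r\in R,\ h\in H\}$$ with multiplication $(\varphi\psi)(h)=\sum\varphi\bigl(s(\psi(h_1))h_2\bigr)$, unit $\varepsilon$, source map $r\mapsto(h\mapsto r\,\varepsilon(h))$, target map $r\mapsto(h\mapsto\varepsilon(h\,s(r)))$, counit $\varphi\mapsto\varphi(1)$, and comultiplication $\varphi\mapsto\sum\varphi_1\otimes\varphi_2$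 determined uniquely by $\sum\varphi_1\bigl(g\,t(\varphi_2(h))\bigr)=\varphi(gh)$ for all $g,h\in H$. **Theorem.** Let $H$ be a left finite $\times_R$-Hopf algebra. Then its left skew dual $H^\vee$ is a $\times_R$-anti-Hopf algebra; that is, the coopposite of $H^\vee$ is a $\times_{\bar R}$-Hopf algebra. -/

import Mathlib

open scoped TensorProduct
open MulOpposite

universe u v

section BalancedTensor

variable (R : Type*) [Ring R]

/-- The subgroup of `M ⊗[ℤ] N` generated by the elements `m · r ⊗ n - m ⊗ r · n`. -/
def balancedRel (M N : Type*) [AddCommGroup M] [Module Rᵐᵒᵖ M] [AddCommGroup N] [Module R N] :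
    AddSubgroup (M ⊗[ℤ] N) :=
  AddSubgroup.closure
    {z | ∃ (r : R) (m : M) (n : N), z = (op r • m) ⊗ₜ[ℤ] n - m ⊗ₜ[ℤ] (r • n)}

/-- The tensor product `M ⊗_R N` of a right `R`-module `M` (that is, a left module over the
opposite ring) and a left `R`-module `N` over a ring `R` that need not be commutative. -/
def BTensor (M N : Type*) [AddCommGroup M] [Module Rᵐᵒᵖ M] [AddCommGroup N] [Module R N] :
    Type _ :=
  (M ⊗[ℤ] N) ⧸ balancedRel R M N

namespace BTensor

section Basic

variable {M N P M' N' : Type*}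
  [AddCommGroup M] [Module Rᵐᵒᵖ M] [AddCommGroup N] [Module R N]
  [AddCommGroup M'] [Module Rᵐᵒᵖ M'] [AddCommGroup N'] [Module R N'] [AddCommGroup P]

instance : AddCommGroup (BTensor R M N) :=
  inferInstanceAs (AddCommGroup ((M ⊗[ℤ] N) ⧸ balancedRel R M N))

/-- The class of a pure tensor. -/
def tmul (m : M) (n : N) : BTensor R M N :=
  QuotientAddGroup.mk' (balancedRel R M N) (m ⊗ₜ[ℤ] n)

variable {R}

theorem tmul_add (m : M) (n n' : N) : tmul R m (n + n') = tmul R m n + tmul R m n' := by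
  unfold tmul
  rw [TensorProduct.tmul_add]
  exact map_add _ _ _

theorem add_tmul (m m' : M) (n : N) : tmul R (m + m') n = tmul R m n + tmul R m' n := by
  unfold tmul
  rw [TensorProduct.add_tmul]
  exact map_add _ _ _

theorem smul_tmul (r : R) (m : M) (n : N) : tmul R (op r • m) n = tmul R m (r • n) := by
  rw [← sub_eq_zero]
  have h : (QuotientAddGroup.mk' (balancedRel R M N))
      ((op r • m) ⊗ₜ[ℤ] n - m ⊗ₜ[ℤ] (r • n)) = 0 :=
    (QuotientAddGroup.eq_zero_iff _).2 (AddSubgroup.subset_closure ⟨r, m, n, rfl⟩)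
  rw [map_sub] at h
  exact h

/-- Pure tensors, as a biadditive map. -/
def tmulHom : M →+ N →+ BTensor R M N :=
  AddMonoidHom.mk' (fun m => AddMonoidHom.mk' (fun n => tmul R m n) (tmul_add m))
    (fun m m' => by ext n; exact add_tmul m m' n)

theorem zero_tmul (n : N) : tmul R (0 : M) n = 0 :=
  map_zero ((tmulHom (R := R) (M := M) (N := N)).flip n)

theorem tmul_zero (m : M) : tmul R m (0 : N) = 0 :=
  map_zero (tmulHom (R := R) (M := M) (N := N) m)

/-- Additive maps out of `M ⊗_R N` from balanced biadditive maps. -/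
def lift (f : M →+ N →+ P) (hf : ∀ (r : R) m n, f (op r • m) n = f m (r • n)) :
    BTensor R M N →+ P :=
  QuotientAddGroup.lift (balancedRel R M N)
    (TensorProduct.liftAddHom f (fun z m n => by simp)) (by
      rw [balancedRel, AddSubgroup.closure_le]
      rintro _ ⟨r, m, n, rfl⟩
      simp [hf])

@[simp] theorem lift_tmul (f : M →+ N →+ P) (hf) (m : M) (n : N) :
    lift (R := R) f hf (tmul R m n) = f m n := rfl

@[elab_as_elim]
theorem induction_on {p : BTensor R M N → Prop} (z : BTensor R M N) (h0 : p 0)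
    (ht : ∀ m n, p (tmul R m n)) (ha : ∀ x y, p x → p y → p (x + y)) : p z := by
  obtain ⟨z, rfl⟩ := QuotientAddGroup.mk'_surjective (balancedRel R M N) z
  induction z using TensorProduct.induction_on with
  | zero => exact h0
  | tmul m n => exact ht m n
  | add x y hx hy => rw [map_add]; exact ha _ _ hx hy

theorem hom_ext {f g : BTensor R M N →+ P} (h : ∀ m n, f (tmul R m n) = g (tmul R m n)) :
    f = g := by
  ext z
  induction z using induction_on with
  | h0 => simp
  | ht m n => exact h m n
  | ha x y hx hy => simp [hx, hy]

/-- The map `f ⊗ g` induced by a right linear `f` and a left linear `g`. -/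
def map (f : M →+ M') (g : N →+ N') (hf : ∀ (r : R) m, f (op r • m) = op r • f m)
    (hg : ∀ (r : R) n, g (r • n) = r • g n) : BTensor R M N →+ BTensor R M' N' :=
  lift (((AddMonoidHom.compHom.flip g).comp tmulHom).comp f) (fun r m n => by
    change tmul R (f (op r • m)) (g n) = tmul R (f m) (g (r • n))
    rw [hf, hg, smul_tmul])

@[simp] theorem map_tmul (f : M →+ M') (g : N →+ N') (hf) (hg) (m : M) (n : N) :
    map (R := R) f g hf hg (tmul R m n) = tmul R (f m) (g n) := rfl

end Basic

section Actions

variable {M N : Type*} [AddCommGroup M] [Module Rᵐᵒᵖ M] [AddCommGroup N] [Module R N]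

/-- If `M` is a bimodule, `M ⊗_R N` is a left module through `M`. -/
instance [Module R M] [SMulCommClass R Rᵐᵒᵖ M] : Module R (BTensor R M N) where
  smul r := map (DistribSMul.toAddMonoidHom M r) (AddMonoidHom.id N)
    (fun _ _ => smul_comm _ _ _) (fun _ _ => rfl)
  one_smul z := DFunLike.congr_fun (hom_ext (g := AddMonoidHom.id _)
    (fun m n => congrArg (fun m => tmul R m n) (one_smul R m))) z
  mul_smul r r' z := DFunLike.congr_fun (hom_ext (g := (map (DistribSMul.toAddMonoidHom M r)
      (AddMonoidHom.id N) (fun _ _ => smul_comm _ _ _) (fun _ _ => rfl)).comp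
      (map (DistribSMul.toAddMonoidHom M r') (AddMonoidHom.id N)
        (fun _ _ => smul_comm _ _ _) (fun _ _ => rfl)))
    (fun m n => congrArg (fun m => tmul R m n) (mul_smul r r' m))) z
  smul_zero _ := map_zero _
  smul_add _ := map_add _
  add_smul r r' z := DFunLike.congr_fun (hom_ext (g := map (DistribSMul.toAddMonoidHom M r)
      (AddMonoidHom.id N) (fun _ _ => smul_comm _ _ _) (fun _ _ => rfl) +
      map (DistribSMul.toAddMonoidHom M r')
      (AddMonoidHom.id N) (fun _ _ => smul_comm _ _ _) (fun _ _ => rfl))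
    (fun m n => (congrArg (fun m => tmul R m n) (add_smul r r' m)).trans (add_tmul _ _ _))) z
  zero_smul z := DFunLike.congr_fun (hom_ext (g := 0)
    (fun m n => (congrArg (fun m => tmul R m n) (zero_smul R m)).trans
      (map_zero ((tmulHom (R := R) (M := M) (N := N)).flip n)))) z

/-- If `N` is a bimodule, `M ⊗_R N` is a right module through `N`. -/
instance [Module Rᵐᵒᵖ N] [SMulCommClass R Rᵐᵒᵖ N] : Module Rᵐᵒᵖ (BTensor R M N) where
  smul r := map (AddMonoidHom.id M) (DistribSMul.toAddMonoidHom N r)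
    (fun _ _ => rfl) (fun _ _ => (smul_comm _ _ _).symm)
  one_smul z := DFunLike.congr_fun (hom_ext (g := AddMonoidHom.id _)
    (fun m n => congrArg (fun n => tmul R m n) (one_smul Rᵐᵒᵖ n))) z
  mul_smul r r' z := DFunLike.congr_fun (hom_ext (g := (map (AddMonoidHom.id M)
      (DistribSMul.toAddMonoidHom N r)
      (fun _ _ => rfl) (fun _ _ => (smul_comm _ _ _).symm)).comp
      (map (AddMonoidHom.id M) (DistribSMul.toAddMonoidHom N r')
        (fun _ _ => rfl) (fun _ _ => (smul_comm _ _ _).symm)))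
    (fun m n => congrArg (fun n => tmul R m n) (mul_smul r r' n))) z
  smul_zero _ := map_zero _
  smul_add _ := map_add _
  add_smul r r' z := DFunLike.congr_fun (hom_ext (g := map (AddMonoidHom.id M)
      (DistribSMul.toAddMonoidHom N r)
      (fun _ _ => rfl) (fun _ _ => (smul_comm _ _ _).symm) +
      map (AddMonoidHom.id M) (DistribSMul.toAddMonoidHom N r')
      (fun _ _ => rfl) (fun _ _ => (smul_comm _ _ _).symm))
    (fun m n => (congrArg (fun n => tmul R m n) (add_smul r r' n)).trans (tmul_add _ _ _))) z
  zero_smul z := DFunLike.congr_fun (hom_ext (g := 0)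
    (fun m n => (congrArg (fun n => tmul R m n) (zero_smul Rᵐᵒᵖ n)).trans
      (map_zero (tmulHom (R := R) (M := M) (N := N) m)))) z

variable {R}

theorem left_smul_tmul [Module R M] [SMulCommClass R Rᵐᵒᵖ M] (r : R) (m : M) (n : N) :
    r • tmul R m n = tmul R (r • m) n := rfl

theorem right_smul_tmul [Module Rᵐᵒᵖ N] [SMulCommClass R Rᵐᵒᵖ N] (r : Rᵐᵒᵖ) (m : M) (n : N) :
    r • tmul R m n = tmul R m (r • n) := rfl

instance [Module R M] [SMulCommClass R Rᵐᵒᵖ M] [Module Rᵐᵒᵖ N] [SMulCommClass R Rᵐᵒᵖ N] :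
    SMulCommClass R Rᵐᵒᵖ (BTensor R M N) where
  smul_comm r r' z := by
    induction z using induction_on with
    | h0 => simp
    | ht m n => rfl
    | ha x y hx hy => simp only [smul_add, hx, hy]

end Actions

section Assoc

variable {M N P : Type*} [AddCommGroup M] [Module Rᵐᵒᵖ M]
  [AddCommGroup N] [Module R N] [Module Rᵐᵒᵖ N] [SMulCommClass R Rᵐᵒᵖ N]
  [AddCommGroup P] [Module R P]

variable {R}

/-- The associativity map `(M ⊗_R N) ⊗_R P → M ⊗_R (N ⊗_R P)`. -/
def assoc : BTensor R (BTensor R M N) P →+ BTensor R M (BTensor R N P) :=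
  lift
    (lift
      (AddMonoidHom.mk' (fun m => AddMonoidHom.mk'
          (fun n => (tmulHom m).comp (tmulHom n))
          (fun n n' => by
            ext p
            exact (congrArg (tmul R m) (add_tmul n n' p)).trans (tmul_add _ _ _)))
        (fun m m' => by ext n p; exact add_tmul m m' _))
      (fun r m n => by ext p; exact smul_tmul r m (tmul R n p)))
    (fun r z p => by
      induction z using induction_on with
      | h0 => simp
      | ht m n => exact congrArg (tmul R m) (smul_tmul r n p)
      | ha x y hx hy => simp only [smul_add, map_add, AddMonoidHom.add_apply, hx, hy])

@[simp] theorem assoc_tmul (m : M) (n : N) (p : P) :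
    assoc (tmul R (tmul R m n) p) = tmul R m (tmul R n p) := rfl

/-- The inverse of the associativity map. -/
def assocInv : BTensor R M (BTensor R N P) →+ BTensor R (BTensor R M N) P :=
  lift
    (AddMonoidHom.mk' (fun m => lift
        (AddMonoidHom.mk' (fun n => tmulHom (tmul R m n)) (fun n n' => by
          ext p
          exact (congrArg (fun z => tmul R z p) (tmul_add m n n')).trans (add_tmul _ _ _)))
        (fun r n p => smul_tmul r (tmul R m n) p))
      (fun m m' => hom_ext fun n p =>
        (congrArg (fun z => tmul R z p) (add_tmul m m' n)).trans (add_tmul _ _ _)))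
    (fun r m z => by
      induction z using induction_on with
      | h0 => simp
      | ht n p => exact congrArg (fun z => tmul R z p) (smul_tmul r m n)
      | ha x y hx hy => simp only [smul_add, map_add, hx, hy])

@[simp] theorem assocInv_tmul (m : M) (n : N) (p : P) :
    assocInv (tmul R m (tmul R n p)) = tmul R (tmul R m n) p := rfl

theorem assoc_assocInv (w : BTensor R M (BTensor R N P)) : assoc (assocInv w) = w := by
  induction w using induction_on with
  | h0 => simp
  | ht m z =>
    induction z using induction_on with
    | h0 => simp [tmul_zero]
    | ht n p => rfl
    | ha x y hx hy => rw [tmul_add]; simp only [map_add, hx, hy]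
  | ha x y hx hy => simp only [map_add, hx, hy]

end Assoc

end BTensor
end BalancedTensor

/-- An `R^e`-ring over `k`, where `R^e = R ⊗ Rᵐᵒᵖ`: a `k`-algebra `H` with a homomorphism of
`k`-algebras `R ⊗ Rᵐᵒᵖ → H`, given by its two components, which have commuting images. -/
structure EnvRing (k R H : Type*) [CommRing k] [Ring R] [Algebra k R] [Ring H] [Algebra k H] where
  /-- the source map -/
  s : R →ₐ[k] H
  /-- the target map -/
  t : Rᵐᵒᵖ →ₐ[k] H
  comm : ∀ r r', s r * t r' = t r' * s r

namespace EnvRing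

section Restriction

variable {k R H : Type*} [CommRing k] [Ring R] [Algebra k R] [Ring H] [Algebra k H]

/-- The underlying functor from `H`-modules to `R^e`-modules, that is, to `R`-bimodules: `E.Res M`
is `M` with `r · m = s(r) m` and `m · r = t(r) m`. -/
def Res (_E : EnvRing k R H) (M : Type*) : Type _ := M

variable (E : EnvRing k R H) (M : Type*) [AddCommGroup M] [Module H M]

instance : AddCommGroup (E.Res M) := inferInstanceAs (AddCommGroup M)

instance : Module H (E.Res M) := inferInstanceAs (Module H M)

instance : Module R (E.Res M) := Module.compHom M E.s.toRingHom

instance : Module Rᵐᵒᵖ (E.Res M) := Module.compHom M E.t.toRingHom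

theorem res_smul (r : R) (m : E.Res M) : r • m = E.s r • m := rfl

theorem res_op_smul (r : Rᵐᵒᵖ) (m : E.Res M) : r • m = E.t r • m := rfl

instance : SMulCommClass R Rᵐᵒᵖ (E.Res M) where
  smul_comm r r' m := by
    simp only [res_smul, res_op_smul, smul_smul, E.comm]

/-- The tensor product `M ⊗_R N` of `H`-modules, formed with respect to the right `R`-module
structure `m · r = t(r) m` of `M` and the left `R`-module structure `r · n = s(r) n` of `N`. -/
abbrev Tens (N : Type*) [AddCommGroup N] [Module H N] : Type _ := BTensor R (E.Res M) (E.Res N)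

variable {M} {N P : Type*} [AddCommGroup N] [Module H N] [AddCommGroup P]

/-- The pure tensor `m ⊗ n` of elements of `H`-modules. -/
def tp (m : M) (n : N) : E.Tens M N := BTensor.tmul R (M := E.Res M) (N := E.Res N) m n

theorem tp_add (m : M) (n n' : N) : E.tp m (n + n') = E.tp m n + E.tp m n' :=
  BTensor.tmul_add (M := E.Res M) (N := E.Res N) m n n'

theorem add_tp (m m' : M) (n : N) : E.tp (m + m') n = E.tp m n + E.tp m' n :=
  BTensor.add_tmul (M := E.Res M) (N := E.Res N) m m' n

theorem tp_smul (r : R) (m : M) (n : N) : E.tp (E.t (op r) • m) n = E.tp m (E.s r • n) :=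
  BTensor.smul_tmul (M := E.Res M) (N := E.Res N) r m n

theorem smul_tp (r : R) (m : M) (n : N) : r • E.tp m n = E.tp (E.s r • m) n := rfl

theorem op_smul_tp (r : Rᵐᵒᵖ) (m : M) (n : N) : r • E.tp m n = E.tp m (E.t r • n) := rfl

/-- Additive maps out of `M ⊗_R N` from balanced biadditive maps. -/
def lift (f : M →+ N →+ P) (hf : ∀ (r : R) m n, f (E.t (op r) • m) n = f m (E.s r • n)) :
    E.Tens M N →+ P :=
  BTensor.lift (M := E.Res M) (N := E.Res N) f hf

@[simp] theorem lift_tp (f : M →+ N →+ P) (hf) (m : M) (n : N) :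
    E.lift f hf (E.tp m n) = f m n := rfl

variable {E} in
@[elab_as_elim]
theorem tens_induction {p : E.Tens M N → Prop} (z : E.Tens M N) (h0 : p 0)
    (ht : ∀ (m : M) (n : N), p (E.tp m n)) (ha : ∀ x y, p x → p y → p (x + y)) : p z :=
  BTensor.induction_on (M := E.Res M) (N := E.Res N) z h0 ht ha

/-- For `m` in `M` and `n` in `N`, the map `H ⊗_R H → M ⊗_R N`, `g ⊗ h ↦ g m ⊗ h n`. -/
def evalAt (m : M) (n : N) : E.Tens H H →+ E.Tens M N :=
  E.lift
    (AddMonoidHom.mk' (fun g => AddMonoidHom.mk' (fun h => E.tp (g • m) (h • n))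
        (fun h h' => by rw [add_smul, tp_add]))
      (fun g g' => by ext h; simp [add_smul, add_tp]))
    (fun r g h => by simp [mul_smul, tp_smul])

@[simp] theorem evalAt_tp (m : M) (n : N) (g h : H) :
    E.evalAt m n (E.tp g h) = E.tp (g • m) (h • n) := rfl

/-- The Takeuchi product `H ×_R H`: the elements `∑ gᵢ ⊗ hᵢ` of `H ⊗_R H` such that
`∑ gᵢ t(r) ⊗ hᵢ = ∑ gᵢ ⊗ hᵢ s(r)` for all `r` in `R`. -/
def takeuchi : AddSubgroup (E.Tens H H) where
  carrier := {x | ∀ r : R, E.evalAt (E.t (op r)) (1 : H) x = E.evalAt (1 : H) (E.s r) x}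
  zero_mem' := fun r => by simp
  add_mem' := fun hx hy r => by simp [hx r, hy r]
  neg_mem' := fun hx r => by simp [hx r]

theorem evalAt_smul_left (a : H) (m : M) (n : N) (x : E.Tens H H) :
    E.evalAt (a • m) n x = E.evalAt m n (E.evalAt a (1 : H) x) := by
  induction x using tens_induction with
  | h0 => simp
  | ht g h => simp [mul_smul]
  | ha x y hx hy => simp only [map_add, hx, hy]

theorem evalAt_smul_right (a : H) (m : M) (n : N) (x : E.Tens H H) :
    E.evalAt m (a • n) x = E.evalAt m n (E.evalAt (1 : H) a x) := by
  induction x using tens_induction with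
  | h0 => simp
  | ht g h => simp [mul_smul]
  | ha x y hx hy => simp only [map_add, hx, hy]

theorem evalAt_add_left (m m' : M) (n : N) (x : E.Tens H H) :
    E.evalAt (m + m') n x = E.evalAt m n x + E.evalAt m' n x := by
  induction x using tens_induction with
  | h0 => simp
  | ht g h => simp [add_tp]
  | ha x y hx hy => simp only [map_add, hx, hy]; abel

theorem evalAt_add_right (m : M) (n n' : N) (x : E.Tens H H) :
    E.evalAt m (n + n') x = E.evalAt m n x + E.evalAt m n' x := by
  induction x using tens_induction with
  | h0 => simp
  | ht g h => simp [tp_add]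
  | ha x y hx hy => simp only [map_add, hx, hy]; abel

variable {E} in
/-- The action of an element `∑ gᵢ ⊗ hᵢ` of `H ×_R H` on `M ⊗_R N`, by
`m ⊗ n ↦ ∑ gᵢ m ⊗ hᵢ n`. For `M = N = H` it is the left multiplication. -/
def act {x : E.Tens H H} (hx : x ∈ E.takeuchi) : E.Tens M N →+ E.Tens M N :=
  E.lift
    (AddMonoidHom.mk' (fun m => AddMonoidHom.mk' (fun n => E.evalAt m n x)
        (fun n n' => E.evalAt_add_right m n n' x))
      (fun m m' => by ext n; exact E.evalAt_add_left m m' n x))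
    (fun r m n => by
      change E.evalAt (E.t (op r) • m) n x = E.evalAt m (E.s r • n) x
      rw [evalAt_smul_left, evalAt_smul_right, hx r])

@[simp] theorem act_tp {x : E.Tens H H} (hx : x ∈ E.takeuchi) (m : M) (n : N) :
    act hx (E.tp m n) = E.evalAt m n x := rfl

/-- The map `g ⊗ h ↦ s(ε(g)) h`. -/
def counitLeft (ε : H →+ R) (hε : ∀ (r : R) (h : H), ε (E.t (op r) * h) = ε h * r) :
    E.Tens H H →+ H :=
  E.lift (((AddMonoidHom.mul (R := H)).comp (E.s : R →+ H)).comp ε) (fun r g h => by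
    change E.s (ε (E.t (op r) * g)) * h = E.s (ε g) * (E.s r * h)
    rw [hε, map_mul, mul_assoc])

@[simp] theorem counitLeft_tp (ε : H →+ R) (hε) (g h : H) :
    E.counitLeft ε hε (E.tp g h) = E.s (ε g) * h := rfl

/-- The map `g ⊗ h ↦ t(ε(h)) g`. -/
def counitRight (ε : H →+ R) (hε : ∀ (r : R) (h : H), ε (E.s r * h) = r * ε h) :
    E.Tens H H →+ H :=
  E.lift ((((AddMonoidHom.mul (R := H)).comp (E.t : Rᵐᵒᵖ →+ H)).comp
      ((opAddEquiv : R ≃+ Rᵐᵒᵖ).toAddMonoidHom.comp ε)).flip) (fun r g h => by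
    change E.t (op (ε h)) * (E.t (op r) * g) = E.t (op (ε (E.s r * h))) * g
    rw [hε, op_mul, map_mul, mul_assoc])

@[simp] theorem counitRight_tp (ε : H →+ R) (hε) (g h : H) :
    E.counitRight ε hε (E.tp g h) = E.t (op (ε h)) * g := rfl

end Restriction

end EnvRing

/-- A `×_R`-bialgebra over `k` (a left bialgebroid with base `R`): an `R^e`-ring `H` with a
comultiplication `H → H ×_R H ⊆ H ⊗_R H` and a counit `H → R`. -/
structure TimesBialgebra (k R H : Type*) [CommRing k] [Ring R] [Algebra k R] [Ring H]
    [Algebra k H] extends EnvRing k R H where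
  /-- the comultiplication -/
  comul : H →+ toEnvRing.Tens H H
  /-- the counit -/
  counit : H →+ R
  comul_s_mul : ∀ (r : R) (h : H), comul (s r * h) = r • comul h
  comul_t_mul : ∀ (r : Rᵐᵒᵖ) (h : H), comul (t r * h) = r • comul h
  counit_s_mul : ∀ (r : R) (h : H), counit (s r * h) = r * counit h
  counit_t_mul : ∀ (r : R) (h : H), counit (t (op r) * h) = counit h * r
  coassoc : ∀ h : H,
    BTensor.assoc (BTensor.map (M := toEnvRing.Res H) comul (AddMonoidHom.id (toEnvRing.Res H))
      (fun r h => comul_t_mul (op r) h) (fun _ _ => rfl) (comul h)) =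
    BTensor.map (N := toEnvRing.Res H) (AddMonoidHom.id (toEnvRing.Res H)) comul
      (fun _ _ => rfl) comul_s_mul (comul h)
  /-- `∑ s(ε(h₁)) h₂ = h` -/
  counit_comul : ∀ h : H, toEnvRing.counitLeft counit counit_t_mul (comul h) = h
  /-- `∑ t(ε(h₂)) h₁ = h` -/
  comul_counit : ∀ h : H, toEnvRing.counitRight counit counit_s_mul (comul h) = h
  comul_mem : ∀ h : H, comul h ∈ toEnvRing.takeuchi
  comul_one : comul 1 = toEnvRing.tp (1 : H) (1 : H)
  comul_mul : ∀ g h : H,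
    comul (g * h) = EnvRing.act (M := H) (N := H) (comul_mem g) (comul h)
  counit_one : counit 1 = 1
  counit_mul_s : ∀ g h : H, counit (g * s (counit h)) = counit (g * h)
  counit_mul_t : ∀ g h : H, counit (g * t (op (counit h))) = counit (g * h)

namespace TimesBialgebra

section Tensor

variable {k R H : Type*} [CommRing k] [Ring R] [Algebra k R] [Ring H] [Algebra k H]
  (B : TimesBialgebra k R H)
  (M N : Type*) [AddCommGroup M] [Module H M] [AddCommGroup N] [Module H N]

/-- The tensor product of the monoidal category of `H`-modules. -/
def Tensor : Type _ := B.toEnvRing.Tens M N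

instance : AddCommGroup (B.Tensor M N) := inferInstanceAs (AddCommGroup (B.toEnvRing.Tens M N))

variable {M N}

theorem evalAt_act {x : B.toEnvRing.Tens H H} (hx : x ∈ B.toEnvRing.takeuchi)
    (y : B.toEnvRing.Tens H H) (m : M) (n : N) :
    B.toEnvRing.evalAt m n (EnvRing.act hx y) = EnvRing.act hx (B.toEnvRing.evalAt m n y) := by
  induction y using EnvRing.tens_induction with
  | h0 => simp
  | ht g h =>
    rw [EnvRing.act_tp, EnvRing.evalAt_tp, EnvRing.act_tp]
    clear hx
    induction x using EnvRing.tens_induction with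
    | h0 => simp
    | ht g h => simp [mul_smul]
    | ha x y hx hy => simp only [map_add, hx, hy]
  | ha x y hx hy => simp only [map_add, hx, hy]

/-- `H` acts on `M ⊗_R N` by `h (m ⊗ n) = ∑ h₁ m ⊗ h₂ n`. -/
instance : Module H (B.Tensor M N) where
  smul h z := EnvRing.act (M := M) (N := N) (B.comul_mem h) z
  one_smul z := by
    change EnvRing.act (M := M) (N := N) (B.comul_mem 1) z = z
    induction z using EnvRing.tens_induction with
    | h0 => exact map_zero _
    | ht m n => rw [EnvRing.act_tp, B.comul_one]; simp
    | ha x y hx hy => exact (map_add _ x y).trans (congrArg₂ _ hx hy)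
  mul_smul g h z := by
    change EnvRing.act (M := M) (N := N) (B.comul_mem (g * h)) z =
      EnvRing.act (B.comul_mem g) (EnvRing.act (B.comul_mem h) z)
    induction z using EnvRing.tens_induction with
    | h0 => simp
    | ht m n =>
      rw [EnvRing.act_tp, EnvRing.act_tp, B.comul_mul, evalAt_act]
    | ha x y hx hy => simp only [map_add, hx, hy]
  smul_zero _ := map_zero _
  smul_add _ := map_add _
  add_smul g h z := by
    change EnvRing.act (M := M) (N := N) (B.comul_mem (g + h)) z =
      EnvRing.act (B.comul_mem g) z + EnvRing.act (B.comul_mem h) z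
    induction z using EnvRing.tens_induction with
    | h0 => simp
    | ht m n => simp only [EnvRing.act_tp, map_add]
    | ha x y hx hy => rw [map_add, hx, hy, map_add, map_add]; abel
  zero_smul z := by
    change EnvRing.act (M := M) (N := N) (B.comul_mem 0) z = 0
    induction z using EnvRing.tens_induction with
    | h0 => simp
    | ht m n => simp only [EnvRing.act_tp, map_zero]
    | ha x y hx hy => simp only [map_add, hx, hy, add_zero]

variable (M N)

/-- The identity map from `M ⊗_R N`, regarded as an `R`-bimodule, to `M ⊗_R N`, regarded as an
`H`-module: the underlying functor is strictly compatible with tensor products. -/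
def tensorEquiv : B.toEnvRing.Tens M N ≃+ B.Tensor M N := AddEquiv.refl _

variable {M N}

theorem smul_tensorEquiv_tp (h : H) (m : M) (n : N) :
    h • B.tensorEquiv M N (B.toEnvRing.tp m n) =
      B.tensorEquiv M N (B.toEnvRing.evalAt m n (B.comul h)) := rfl

theorem tensorEquiv_smul (r : R) (z : B.toEnvRing.Tens M N) :
    B.tensorEquiv M N (r • z) = B.s r • B.tensorEquiv M N z := by
  induction z using EnvRing.tens_induction with
  | h0 => simp
  | ht m n =>
    rw [smul_tensorEquiv_tp, ← mul_one (B.s r), B.comul_s_mul, B.comul_one, EnvRing.smul_tp]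
    simp [EnvRing.smul_tp]
  | ha x y hx hy => simp only [map_add, smul_add, hx, hy]

theorem tensorEquiv_op_smul (r : Rᵐᵒᵖ) (z : B.toEnvRing.Tens M N) :
    B.tensorEquiv M N (r • z) = B.t r • B.tensorEquiv M N z := by
  induction z using EnvRing.tens_induction with
  | h0 => simp
  | ht m n =>
    rw [smul_tensorEquiv_tp, ← mul_one (B.t r), B.comul_t_mul, B.comul_one, EnvRing.op_smul_tp]
    simp [EnvRing.op_smul_tp]
  | ha x y hx hy => simp only [map_add, smul_add, hx, hy]

end Tensor

end TimesBialgebra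

/-- The map `f` is a homomorphism of `R`-bimodules. -/
structure IsBimoduleHom (R : Type*) [Ring R] {M N : Type*} [AddCommGroup M] [AddCommGroup N]
    [Module R M] [Module Rᵐᵒᵖ M] [Module R N] [Module Rᵐᵒᵖ N] (f : M →+ N) : Prop where
  map_smul : ∀ (r : R) (m : M), f (r • m) = r • f m
  map_op_smul : ∀ (r : Rᵐᵒᵖ) (m : M), f (r • m) = r • f m

/-- The bimodule `P` with the bimodule map `ev : P ⊗_R M → N` is a right inner hom from `M` to `N`
in the monoidal category of left `R^e`-modules, that is, of `R`-bimodules on which the two actions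
of `k` agree: bimodule maps `X ⊗_R M → N` correspond to bimodule maps `X → P`. -/
def IsBimoduleRightInnerHom (k : Type v) (R : Type u) [CommRing k] [Ring R] [Algebra k R]
    {M N P : Type u} [AddCommGroup M] [Module R M] [Module Rᵐᵒᵖ M] [SMulCommClass R Rᵐᵒᵖ M]
    [AddCommGroup N] [Module R N] [Module Rᵐᵒᵖ N]
    [AddCommGroup P] [Module R P] [Module Rᵐᵒᵖ P] [SMulCommClass R Rᵐᵒᵖ P]
    (ev : BTensor R P M →+ N) : Prop :=
  IsBimoduleHom R ev ∧
  ∀ (X : Type u) [AddCommGroup X] [Module R X] [Module Rᵐᵒᵖ X] [SMulCommClass R Rᵐᵒᵖ X],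
    (∀ (c : k) (x : X), algebraMap k R c • x = op (algebraMap k R c) • x) →
    ∀ f : BTensor R X M →+ N, IsBimoduleHom R f →
      ∃! g : X →+ P, IsBimoduleHom R g ∧
        ∀ x m, ev (BTensor.tmul R (g x) m) = f (BTensor.tmul R x m)

namespace TimesBialgebra

section Hopf

variable {k : Type v} {R H : Type u} [CommRing k] [Ring R] [Algebra k R] [Ring H] [Algebra k H]
  (B : TimesBialgebra k R H)

/-- The `H`-module `P` with the `H`-linear map `ev : P ⊗_R M → N` is a right inner hom from `M`
to `N` in the monoidal category of `H`-modules: `H`-linear maps `X ⊗_R M → N` correspond to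
`H`-linear maps `X → P`. -/
def IsRightInnerHom {M N P : Type u} [AddCommGroup M] [Module H M] [AddCommGroup N] [Module H N]
    [AddCommGroup P] [Module H P] (ev : B.Tensor P M →ₗ[H] N) : Prop :=
  ∀ (X : Type u) [AddCommGroup X] [Module H X] (f : B.Tensor X M →ₗ[H] N),
    ∃! g : X →ₗ[H] P, ∀ x m, ev (B.tensorEquiv P M (B.toEnvRing.tp (g x) m)) =
      f (B.tensorEquiv X M (B.toEnvRing.tp x m))

/-- A `×_R`-bialgebra `H` is a `×_R`-Hopf algebra if the underlying functor from `H`-modules to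
`R^e`-modules preserves right inner homs. -/
def IsHopf : Prop :=
  ∀ (M N P : Type u) [AddCommGroup M] [Module H M] [AddCommGroup N] [Module H N]
    [AddCommGroup P] [Module H P] (ev : B.Tensor P M →ₗ[H] N), B.IsRightInnerHom ev →
    IsBimoduleRightInnerHom k R (M := B.toEnvRing.Res M) (N := B.toEnvRing.Res N)
      (P := B.toEnvRing.Res P) (ev.toAddMonoidHom.comp (B.tensorEquiv P M).toAddMonoidHom)

end Hopf

end TimesBialgebra

namespace EnvRing

section Coop

variable {k R H : Type*} [CommRing k] [Ring R] [Algebra k R] [Ring H] [Algebra k H]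
  (E : EnvRing k R H)

/-- `H` as an `R^e`-ring over the opposite base, with source and target interchanged. -/
def coop : EnvRing k Rᵐᵒᵖ H where
  s := E.t
  t := E.s.comp (AlgEquiv.opOp k R).symm.toAlgHom
  comm r _ := (E.comm _ r).symm

variable (M N : Type*) [AddCommGroup M] [Module H M] [AddCommGroup N] [Module H N]

variable {M N} in
/-- The interchange of tensor factors. -/
def swap : E.Tens M N →+ E.coop.Tens N M :=
  E.lift
    (AddMonoidHom.mk' (fun m => AddMonoidHom.mk' (fun n => E.coop.tp n m)
        (fun n n' => E.coop.add_tp n n' m))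
      (fun m m' => by ext n; exact E.coop.tp_add n m m'))
    (fun r m n => (E.coop.tp_smul (op r) n m).symm)

variable {M N}

@[simp] theorem swap_tp (m : M) (n : N) : E.swap (E.tp m n) = E.coop.tp n m := rfl

theorem swap_smul (r : R) (z : E.Tens M N) : E.swap (r • z) = op (op r) • E.swap z := by
  induction z using EnvRing.tens_induction with
  | h0 => simp
  | ht m n => rfl
  | ha x y hx hy => simp only [smul_add, map_add, hx, hy]

theorem swap_op_smul (r : Rᵐᵒᵖ) (z : E.Tens M N) : E.swap (r • z) = r • E.swap z := by
  induction z using EnvRing.tens_induction with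
  | h0 => simp
  | ht m n => rfl
  | ha x y hx hy => simp only [smul_add, map_add, hx, hy]

theorem swap_evalAt (m : M) (n : N) (z : E.Tens H H) :
    E.swap (E.evalAt m n z) = E.coop.evalAt n m (E.swap z) := by
  induction z using EnvRing.tens_induction with
  | h0 => simp
  | ht m n => rfl
  | ha x y hx hy => simp only [map_add, hx, hy]

/-- The map `m ⊗ (n ⊗ p) ↦ (p ⊗ n) ⊗ m`. -/
def swapRight {P : Type*} [AddCommGroup P] [Module H P] :
    BTensor R (E.Res M) (E.Tens N P) →+ BTensor Rᵐᵒᵖ (E.coop.Tens P N) (E.coop.Res M) :=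
  BTensor.lift (M := E.Res M)
    (AddMonoidHom.flip ((BTensor.tmulHom (R := Rᵐᵒᵖ) (M := E.coop.Tens P N)
      (N := E.coop.Res M)).comp E.swap))
    (fun r m z => ((congrArg (fun w => BTensor.tmul Rᵐᵒᵖ (N := E.coop.Res M) w m)
      (E.swap_smul r z)).trans
        (BTensor.smul_tmul (N := E.coop.Res M) (op r) (E.swap z) m)).symm)

/-- The map `(m ⊗ n) ⊗ p ↦ p ⊗ (n ⊗ m)`. -/
def swapLeft {P : Type*} [AddCommGroup P] [Module H P] :
    BTensor R (E.Tens M N) (E.Res P) →+ BTensor Rᵐᵒᵖ (E.coop.Res P) (E.coop.Tens N M) :=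
  BTensor.lift (N := E.Res P)
    ((AddMonoidHom.flip (BTensor.tmulHom (R := Rᵐᵒᵖ) (M := E.coop.Res P)
      (N := E.coop.Tens N M))).comp E.swap)
    (fun r z p => (congrArg (BTensor.tmul Rᵐᵒᵖ (M := E.coop.Res P) p)
      (E.swap_op_smul (op r) z)).trans
        (BTensor.smul_tmul (M := E.coop.Res P) (op r) p (E.swap z)).symm)

theorem assoc_swapRight {P : Type*} [AddCommGroup P] [Module H P]
    (w : BTensor R (E.Tens M N) (E.Res P)) :
    BTensor.assoc (E.swapRight (M := M) (N := N) (P := P) (BTensor.assoc w)) =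
      E.swapLeft w := by
  induction w using BTensor.induction_on with
  | h0 => simp
  | ht z p =>
    induction z using EnvRing.tens_induction with
    | h0 =>
      rw [BTensor.zero_tmul]
      simp
    | ht m n => rfl
    | ha x y hx hy => rw [BTensor.add_tmul]; simp only [map_add, hx, hy]
  | ha x y hx hy => simp only [map_add, hx, hy]

theorem counitLeft_swap (ε : H →+ R) (hε : ∀ (r : R) (h : H), ε (E.s r * h) = r * ε h) (hε')
    (z : E.Tens H H) :
    E.coop.counitLeft ((opAddEquiv : R ≃+ Rᵐᵒᵖ).toAddMonoidHom.comp ε) hε' (E.swap z) =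
      E.counitRight ε hε z := by
  induction z using EnvRing.tens_induction with
  | h0 => simp
  | ht m n => rw [swap_tp, counitLeft_tp, counitRight_tp]; rfl
  | ha x y hx hy => simp only [map_add, hx, hy]

theorem counitRight_swap (ε : H →+ R)
    (hε : ∀ (r : R) (h : H), ε (E.t (op r) * h) = ε h * r) (hε') (z : E.Tens H H) :
    E.coop.counitRight ((opAddEquiv : R ≃+ Rᵐᵒᵖ).toAddMonoidHom.comp ε) hε' (E.swap z) =
      E.counitLeft ε hε z := by
  induction z using EnvRing.tens_induction with
  | h0 => simp
  | ht m n => rw [swap_tp, counitLeft_tp, counitRight_tp]; rfl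
  | ha x y hx hy => simp only [map_add, hx, hy]

end Coop

end EnvRing

namespace TimesBialgebra

section Coop

variable {k R H : Type*} [CommRing k] [Ring R] [Algebra k R] [Ring H] [Algebra k H]
  (B : TimesBialgebra k R H)

theorem swap_comul_t_mul (r : Rᵐᵒᵖ) (h : H) :
    B.toEnvRing.swap (B.comul (B.t r * h)) = r • B.toEnvRing.swap (B.comul h) := by
  rw [B.comul_t_mul, EnvRing.swap_op_smul]

theorem swap_comul_s_mul (r : Rᵐᵒᵖ) (h : H) :
    B.toEnvRing.swap (B.comul (B.s r.unop * h)) = op r • B.toEnvRing.swap (B.comul h) := by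
  rw [B.comul_s_mul, EnvRing.swap_smul]; rfl

theorem map_comul_swap (z : B.toEnvRing.Tens H H) :
    BTensor.map (M := B.toEnvRing.coop.Res H)
        (B.toEnvRing.swap.comp B.comul) (AddMonoidHom.id (B.toEnvRing.coop.Res H))
        (fun r h => B.swap_comul_s_mul r h) (fun _ _ => rfl) (B.toEnvRing.swap z) =
        B.toEnvRing.swapRight (BTensor.map (N := B.toEnvRing.Res H)
          (AddMonoidHom.id (B.toEnvRing.Res H)) B.comul (fun _ _ => rfl) B.comul_s_mul z) := by
  induction z using EnvRing.tens_induction with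
  | h0 => simp
  | ht m n => rfl
  | ha x y hx hy => simp only [map_add, hx, hy]

theorem map_swap_comul (z : B.toEnvRing.Tens H H) :
    BTensor.map (N := B.toEnvRing.coop.Res H)
        (AddMonoidHom.id (B.toEnvRing.coop.Res H)) (B.toEnvRing.swap.comp B.comul)
        (fun _ _ => rfl) B.swap_comul_t_mul (B.toEnvRing.swap z) =
        B.toEnvRing.swapLeft (BTensor.map (M := B.toEnvRing.Res H) B.comul
          (AddMonoidHom.id (B.toEnvRing.Res H))
          (fun r h => B.comul_t_mul (op r) h) (fun _ _ => rfl) z) := by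
  induction z using EnvRing.tens_induction with
  | h0 => simp
  | ht m n => rfl
  | ha x y hx hy => simp only [map_add, hx, hy]

/-- The coopposite of a `×_R`-bialgebra, a `×_{Rᵐᵒᵖ}`-bialgebra: source and target are
interchanged and the comultiplication is composed with the interchange of tensor factors. -/
def coop : TimesBialgebra k Rᵐᵒᵖ H where
  toEnvRing := B.toEnvRing.coop
  comul := B.toEnvRing.swap.comp B.comul
  counit := (opAddEquiv : R ≃+ Rᵐᵒᵖ).toAddMonoidHom.comp B.counit
  comul_s_mul r h := by
    exact B.swap_comul_t_mul r h
  comul_t_mul r h := by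
    exact B.swap_comul_s_mul r.unop h
  counit_s_mul r h := by
    change op (B.counit (B.t (op r.unop) * h)) = r * op (B.counit h)
    rw [B.counit_t_mul]; rfl
  counit_t_mul r h := by
    change op (B.counit (B.s r.unop * h)) = op (B.counit h) * r
    rw [B.counit_s_mul]; rfl
  coassoc h := by
    refine (congrArg BTensor.assoc (B.map_comul_swap (B.comul h))).trans
      (Eq.trans ?_ (B.map_swap_comul (B.comul h)).symm)
    rw [← B.coassoc, EnvRing.assoc_swapRight]
  counit_comul h :=
    (B.toEnvRing.counitLeft_swap B.counit B.counit_s_mul _ (B.comul h)).trans (B.comul_counit h)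
  comul_counit h :=
    (B.toEnvRing.counitRight_swap B.counit B.counit_t_mul _ (B.comul h)).trans (B.counit_comul h)
  comul_mem h r := by
    change B.toEnvRing.coop.evalAt (B.s r.unop) (1 : H) (B.toEnvRing.swap (B.comul h)) =
      B.toEnvRing.coop.evalAt (1 : H) (B.t r) (B.toEnvRing.swap (B.comul h))
    rw [← EnvRing.swap_evalAt, ← EnvRing.swap_evalAt]
    exact congrArg _ (B.comul_mem h r.unop).symm
  comul_one := by
    change B.toEnvRing.swap (B.comul 1) = _
    rw [B.comul_one]; rfl
  comul_mul g h := by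
    change B.toEnvRing.swap (B.comul (g * h)) = _
    rw [B.comul_mul]
    change _ = EnvRing.act _ (B.toEnvRing.swap (B.comul h))
    generalize B.comul h = z
    induction z using EnvRing.tens_induction with
    | h0 => simp
    | ht m n => exact B.toEnvRing.swap_evalAt m n _
    | ha x y hx hy => simp only [map_add, hx, hy]
  counit_one := congrArg op B.counit_one
  counit_mul_s g h := congrArg op (B.counit_mul_t g h)
  counit_mul_t g h := congrArg op (B.counit_mul_s g h)

end Coop

end TimesBialgebra

namespace TimesBialgebra

section Dual

variable {k R H : Type*} [CommRing k] [Ring R] [Algebra k R] [Ring H] [Algebra k H]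
  (B : TimesBialgebra k R H)

theorem comul_mul_s (r : R) (h : H) :
    B.comul (h * B.s r) = B.toEnvRing.evalAt (B.s r) (1 : H) (B.comul h) := by
  have h1 : B.comul (B.s r) = B.toEnvRing.tp (B.s r) (1 : H) := by
    rw [← mul_one (B.s r), B.comul_s_mul, B.comul_one, EnvRing.smul_tp]; simp
  rw [B.comul_mul, h1, EnvRing.act_tp]

theorem comul_mul_t (r : Rᵐᵒᵖ) (h : H) :
    B.comul (h * B.t r) = B.toEnvRing.evalAt (1 : H) (B.t r) (B.comul h) := by
  have h1 : B.comul (B.t r) = B.toEnvRing.tp (1 : H) (B.t r) := by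
    rw [← mul_one (B.t r), B.comul_t_mul, B.comul_one, EnvRing.op_smul_tp]; simp
  rw [B.comul_mul, h1, EnvRing.act_tp]

theorem counit_s (r : R) : B.counit (B.s r) = r := by
  rw [← mul_one (B.s r), B.counit_s_mul, B.counit_one, mul_one]

theorem counit_mul_t_eq (r : R) (h : H) : B.counit (h * B.t (op r)) = B.counit (h * B.s r) := by
  rw [← B.counit_mul_t h (B.s r), counit_s]

/-- The set `Hom_{R̄-}(H, R)` of additive maps `φ : H → R` such that `φ(t(r) h) = φ(h) r`. -/
def SkewDual : Type _ := B.toEnvRing.Res H →ₗ[Rᵐᵒᵖ] R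

namespace SkewDual

instance (priority := 10) : AddCommGroup B.SkewDual :=
  inferInstanceAs (AddCommGroup (B.toEnvRing.Res H →ₗ[Rᵐᵒᵖ] R))

instance : FunLike B.SkewDual H R where
  coe φ := (show B.toEnvRing.Res H →ₗ[Rᵐᵒᵖ] R from φ)
  coe_injective _ _ h := LinearMap.ext (fun x => congrFun h x)

instance : AddMonoidHomClass B.SkewDual H R where
  map_add φ := LinearMap.map_add (show B.toEnvRing.Res H →ₗ[Rᵐᵒᵖ] R from φ)
  map_zero φ := LinearMap.map_zero (show B.toEnvRing.Res H →ₗ[Rᵐᵒᵖ] R from φ)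

variable {B}

@[ext] theorem ext {φ ψ : B.SkewDual} (h : ∀ x, φ x = ψ x) : φ = ψ := DFunLike.ext _ _ h

theorem map_t_mul (φ : B.SkewDual) (r : R) (h : H) : φ (B.t (op r) * h) = φ h * r :=
  LinearMap.map_smul (show B.toEnvRing.Res H →ₗ[Rᵐᵒᵖ] R from φ) (op r) h

/-- Elements of `Hom_{R̄-}(H, R)` from functions. -/
def mk (f : H →+ R) (hf : ∀ (r : R) (h : H), f (B.t (op r) * h) = f h * r) : B.SkewDual :=
  (⟨⟨f, f.map_add⟩, fun r h => hf r.unop h⟩ : B.toEnvRing.Res H →ₗ[Rᵐᵒᵖ] R)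

@[simp] theorem mk_apply (f : H →+ R) (hf) (h : H) : (mk f hf : B.SkewDual) h = f h := rfl

@[simp] theorem add_apply (φ ψ : B.SkewDual) (h : H) : (φ + ψ) h = φ h + ψ h := rfl

@[simp] theorem zero_apply (h : H) : (0 : B.SkewDual) h = 0 := rfl

/-- Evaluation at an element of `H`. -/
def apply (h : H) : B.SkewDual →+ R where
  toFun φ := φ h
  map_zero' := rfl
  map_add' _ _ := rfl

theorem sum_apply {ι : Type*} (S : Finset ι) (φ : ι → B.SkewDual) (h : H) :
    (∑ i ∈ S, φ i) h = ∑ i ∈ S, φ i h := map_sum (apply h) φ S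

/-- The map `H ⊗_R H → R`, `g ⊗ h ↦ φ(s(ψ(g)) h)`. -/
def conv (φ ψ : B.SkewDual) : B.toEnvRing.Tens H H →+ R :=
  B.toEnvRing.lift
    (AddMonoidHom.mk' (fun g => AddMonoidHom.mk' (fun h => φ (B.s (ψ g) * h))
        (fun h h' => by simp [mul_add]))
      (fun g g' => by ext h; simp [add_mul]))
    (fun r g h => by simp [map_t_mul, mul_assoc])

@[simp] theorem conv_tp (φ ψ : B.SkewDual) (g h : H) :
    conv φ ψ (B.toEnvRing.tp g h) = φ (B.s (ψ g) * h) := rfl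

theorem conv_op_smul (φ ψ : B.SkewDual) (r : R) (z : B.toEnvRing.Tens H H) :
    conv φ ψ (op r • z) = conv φ ψ z * r := by
  induction z using EnvRing.tens_induction with
  | h0 => simp
  | ht g h =>
    rw [EnvRing.op_smul_tp, conv_tp, conv_tp, smul_eq_mul, ← map_t_mul, ← mul_assoc, B.comm,
      mul_assoc]
  | ha x y hx hy => simp only [smul_add, map_add, hx, hy, add_mul]

/-- The multiplication of the skew dual: `(φ ψ)(h) = ∑ φ(s(ψ(h₁)) h₂)`. -/
instance : Mul B.SkewDual where
  mul φ ψ := mk ((conv φ ψ).comp B.comul) (fun r h => by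
    rw [AddMonoidHom.comp_apply, AddMonoidHom.comp_apply, B.comul_t_mul, conv_op_smul])

/-- The unit of the skew dual is the counit of `H`. -/
instance : One B.SkewDual where
  one := mk B.counit B.counit_t_mul

theorem mul_apply (φ ψ : B.SkewDual) (h : H) : (φ * ψ) h = conv φ ψ (B.comul h) := rfl

theorem one_apply (h : H) : (1 : B.SkewDual) h = B.counit h := rfl

theorem conv_one_left (φ : B.SkewDual) (z : B.toEnvRing.Tens H H) :
    conv 1 φ z = φ (B.toEnvRing.counitRight B.counit B.counit_s_mul z) := by
  induction z using EnvRing.tens_induction with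
  | h0 => simp
  | ht g h => simp [one_apply, B.counit_s_mul, map_t_mul]
  | ha x y hx hy => simp only [map_add, hx, hy]

theorem conv_one_right (φ : B.SkewDual) (z : B.toEnvRing.Tens H H) :
    conv φ 1 z = φ (B.toEnvRing.counitLeft B.counit B.counit_t_mul z) := by
  induction z using EnvRing.tens_induction with
  | h0 => simp
  | ht g h => simp [one_apply]
  | ha x y hx hy => simp only [map_add, hx, hy]

/-- The map `a ⊗ (b ⊗ c) ↦ φ(s(ψ(s(χ(a)) b)) c)`. -/
def tripleConv (φ ψ χ : B.SkewDual) :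
    BTensor R (B.toEnvRing.Res H) (B.toEnvRing.Tens H H) →+ R :=
  BTensor.lift (M := B.toEnvRing.Res H)
    (AddMonoidHom.mk' (fun a : H => AddMonoidHom.mk' (fun z => conv φ ψ (χ a • z))
        (fun z z' => by rw [smul_add, map_add]))
      (fun a a' : H => by
        ext z
        exact (congrArg (fun x : R => conv φ ψ (x • z)) (map_add χ a a')).trans
          ((congrArg (conv φ ψ) (add_smul (χ a) (χ a') z)).trans (map_add _ _ _))))
    (fun r a z => congrArg (conv φ ψ)
      ((congrArg (fun x : R => x • z) (map_t_mul χ r a)).trans (mul_smul (χ a) r z)))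

theorem tripleConv_map_right (φ ψ χ : B.SkewDual) (z : B.toEnvRing.Tens H H) :
    tripleConv φ ψ χ (BTensor.map (N := B.toEnvRing.Res H) (AddMonoidHom.id (B.toEnvRing.Res H))
      B.comul (fun _ _ => rfl) B.comul_s_mul z) = conv (φ * ψ) χ z := by
  induction z using EnvRing.tens_induction with
  | h0 => simp
  | ht g h =>
    rw [conv_tp, mul_apply, B.comul_s_mul]; rfl
  | ha x y hx hy => simp only [map_add, hx, hy]

theorem tripleConv_assoc (φ ψ χ : B.SkewDual) (z : B.toEnvRing.Tens H H) (h : H) :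
    tripleConv φ ψ χ (BTensor.assoc (BTensor.tmul R (N := B.toEnvRing.Res H) z h)) =
      φ (B.s (conv ψ χ z) * h) := by
  induction z using EnvRing.tens_induction with
  | h0 =>
    refine (congrArg (fun w => tripleConv φ ψ χ (BTensor.assoc w))
      (BTensor.zero_tmul (M := B.toEnvRing.Tens H H) (N := B.toEnvRing.Res H) h)).trans ?_
    simp
  | ht g h => rfl
  | ha x y hx hy =>
    refine (congrArg (fun w => tripleConv φ ψ χ (BTensor.assoc w))
      (BTensor.add_tmul (N := B.toEnvRing.Res H) x y h)).trans ?_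
    simp only [map_add, hx, hy, add_mul]

theorem tripleConv_map_left (φ ψ χ : B.SkewDual) (z : B.toEnvRing.Tens H H) :
    tripleConv φ ψ χ (BTensor.assoc (BTensor.map (M := B.toEnvRing.Res H) B.comul
      (AddMonoidHom.id (B.toEnvRing.Res H)) (fun r h => B.comul_t_mul (op r) h) (fun _ _ => rfl)
      z)) = conv φ (ψ * χ) z := by
  induction z using EnvRing.tens_induction with
  | h0 => simp
  | ht g h =>
    rw [conv_tp, mul_apply, ← tripleConv_assoc]; rfl
  | ha x y hx hy => simp only [map_add, hx, hy]

theorem conv_add_left (φ φ' ψ : B.SkewDual) (z : B.toEnvRing.Tens H H) :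
    conv (φ + φ') ψ z = conv φ ψ z + conv φ' ψ z := by
  induction z using EnvRing.tens_induction with
  | h0 => simp
  | ht g h => simp
  | ha x y hx hy => simp only [map_add, hx, hy]; abel

theorem conv_add_right (φ ψ ψ' : B.SkewDual) (z : B.toEnvRing.Tens H H) :
    conv φ (ψ + ψ') z = conv φ ψ z + conv φ ψ' z := by
  induction z using EnvRing.tens_induction with
  | h0 => simp
  | ht g h => simp [add_mul]
  | ha x y hx hy => simp only [map_add, hx, hy]; abel

theorem conv_zero_left (ψ : B.SkewDual) (z : B.toEnvRing.Tens H H) : conv 0 ψ z = 0 := by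
  have h := conv_add_left 0 0 ψ z
  rw [add_zero] at h
  exact left_eq_add.1 h

theorem conv_zero_right (φ : B.SkewDual) (z : B.toEnvRing.Tens H H) : conv φ 0 z = 0 := by
  have h := conv_add_right φ 0 0 z
  rw [add_zero] at h
  exact left_eq_add.1 h

instance : Ring B.SkewDual where
  __ := (inferInstance : AddCommGroup B.SkewDual)
  __ := (inferInstance : Mul B.SkewDual)
  __ := (inferInstance : One B.SkewDual)
  left_distrib φ ψ ψ' := ext fun h => conv_add_right φ ψ ψ' (B.comul h)
  right_distrib φ φ' ψ := ext fun h => conv_add_left φ φ' ψ (B.comul h)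
  zero_mul ψ := ext fun h => conv_zero_left ψ (B.comul h)
  mul_zero φ := ext fun h => conv_zero_right φ (B.comul h)
  mul_assoc φ ψ χ := ext fun h => by
    rw [mul_apply (φ * ψ), mul_apply φ, ← tripleConv_map_right, ← tripleConv_map_left, B.coassoc]
  one_mul φ := ext fun h => by rw [mul_apply, conv_one_left, B.comul_counit]
  mul_one φ := ext fun h => by rw [mul_apply, conv_one_right, B.counit_comul]

/-- The element `h ↦ r ε(h)` of the skew dual. -/
def source (r : R) : B.SkewDual :=
  mk ((AddMonoidHom.mulLeft r).comp B.counit) (fun r' h => by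
    simp [B.counit_t_mul, mul_assoc])

/-- The element `h ↦ ε(h s(r))` of the skew dual. -/
def target (r : R) : B.SkewDual :=
  mk (B.counit.comp (AddMonoidHom.mulRight (B.s r))) (fun r' h => by
    simp [B.counit_t_mul, mul_assoc])

theorem source_apply (r : R) (h : H) : (source r : B.SkewDual) h = r * B.counit h := rfl

theorem target_apply (r : R) (h : H) : (target r : B.SkewDual) h = B.counit (h * B.s r) := rfl

theorem source_mul_apply (r : R) (φ : B.SkewDual) (h : H) :
    (source r * φ : B.SkewDual) h = r * φ h := by
  have key : ∀ z, conv (source r) φ z = r * conv 1 φ z := by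
    intro z
    induction z using EnvRing.tens_induction with
    | h0 => simp
    | ht g h => simp [source_apply, one_apply]
    | ha x y hx hy => simp only [map_add, hx, hy, mul_add]
  rw [mul_apply, key, ← mul_apply, one_mul]

theorem mul_source_apply (r : R) (φ : B.SkewDual) (h : H) :
    (φ * source r : B.SkewDual) h = φ (B.s r * h) := by
  have key : ∀ z, conv φ (source r) z =
      φ (B.s r * B.toEnvRing.counitLeft B.counit B.counit_t_mul z) := by
    intro z
    induction z using EnvRing.tens_induction with
    | h0 => simp
    | ht g h => simp [source_apply, mul_assoc]
    | ha x y hx hy => simp only [map_add, hx, hy, mul_add]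
  rw [mul_apply, key, B.counit_comul]

theorem target_mul_apply (r : R) (φ : B.SkewDual) (h : H) :
    (target r * φ : B.SkewDual) h = φ (h * B.t (op r)) := by
  have key : ∀ z, conv (target r) φ z =
      conv 1 φ (B.toEnvRing.evalAt (1 : H) (B.t (op r)) z) := by
    intro z
    induction z using EnvRing.tens_induction with
    | h0 => simp
    | ht g h => simp [target_apply, one_apply, mul_assoc, B.counit_s_mul, B.counit_mul_t_eq]
    | ha x y hx hy => simp only [map_add, hx, hy]
  rw [mul_apply, key, ← B.comul_mul_t, ← mul_apply, one_mul]

theorem mul_target_apply (r : R) (φ : B.SkewDual) (h : H) :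
    (φ * target r : B.SkewDual) h = φ (h * B.s r) := by
  have key : ∀ z, conv φ (target r) z =
      conv φ 1 (B.toEnvRing.evalAt (B.s r) (1 : H) z) := by
    intro z
    induction z using EnvRing.tens_induction with
    | h0 => simp
    | ht g h => simp [target_apply, one_apply]
    | ha x y hx hy => simp only [map_add, hx, hy]
  rw [mul_apply, key, ← B.comul_mul_s, ← mul_apply, mul_one]

/-- The source map of the skew dual. -/
def sourceHom : R →+* B.SkewDual where
  toFun := source
  map_one' := ext fun h => one_mul _
  map_mul' r r' := ext fun h => by
    rw [source_mul_apply, source_apply, source_apply, mul_assoc]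
  map_zero' := ext fun h => zero_mul _
  map_add' r r' := ext fun h => add_mul _ _ _

/-- The skew dual is an algebra over `k` through its source map. -/
instance : Algebra k B.SkewDual :=
  RingHom.toAlgebra' (sourceHom.comp (algebraMap k R)) (fun c φ => ext fun h => by
    change (source (algebraMap k R c) * φ : B.SkewDual) h =
      (φ * source (algebraMap k R c) : B.SkewDual) h
    have h1 : B.s (algebraMap k R c) = B.t (op (algebraMap k R c)) := by
      rw [AlgHom.commutes, ← MulOpposite.algebraMap_apply, AlgHom.commutes]
    rw [source_mul_apply, mul_source_apply, h1, map_t_mul, Algebra.commutes])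

theorem algebraMap_eq (c : k) : algebraMap k B.SkewDual c = source (algebraMap k R c) := rfl

end SkewDual

open SkewDual in
/-- The `R^e`-ring structure of the skew dual: the source map sends `r` to `h ↦ r ε(h)`, the
target map sends `r` to `h ↦ ε(h s(r))`. -/
def dualEnvRing : EnvRing k R B.SkewDual where
  s := { sourceHom with commutes' := fun c => rfl }
  t :=
    { toFun := fun r => target r.unop
      map_one' := SkewDual.ext fun h => by simp [target_apply, one_apply]
      map_mul' := fun r r' => SkewDual.ext fun h => by
        rw [target_mul_apply, target_apply, target_apply, unop_mul, map_mul B.s, ← mul_assoc,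
          ← B.counit_mul_t_eq, mul_assoc, mul_assoc, op_unop, B.comm]
      map_zero' := SkewDual.ext fun h => by simp [target_apply]
      map_add' := fun r r' => SkewDual.ext fun h => by simp [target_apply, mul_add]
      commutes' := fun c => SkewDual.ext fun h => by
        have h1 : h * B.s (algebraMap k R c) = B.s (algebraMap k R c) * h := by
          rw [AlgHom.commutes, Algebra.commutes]
        rw [algebraMap_eq, source_apply, target_apply, MulOpposite.algebraMap_apply, unop_op, h1,
          B.counit_s_mul] }
  comm r r' := SkewDual.ext fun h => by
    change (source r * target r'.unop : B.SkewDual) h = (target r'.unop * source r : B.SkewDual) h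
    rw [source_mul_apply, target_mul_apply, source_apply, target_apply, B.counit_mul_t_eq]

end Dual

end TimesBialgebra

namespace TimesBialgebra

section Dual

variable {k R H : Type*} [CommRing k] [Ring R] [Algebra k R] [Ring H] [Algebra k H]
  (B : TimesBialgebra k R H)

/-- `H` is left finite if it is finitely generated projective as a left module over `Rᵐᵒᵖ`, acting
by left multiplication through the target map. -/
def LeftFinite : Prop :=
  Module.Finite Rᵐᵒᵖ (B.toEnvRing.Res H) ∧ Module.Projective Rᵐᵒᵖ (B.toEnvRing.Res H)

theorem LeftFinite.exists_dualBasis {B : TimesBialgebra k R H} (hB : B.LeftFinite) :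
    ∃ (n : ℕ) (b : Fin n → H) (c : Fin n → B.SkewDual),
      ∀ h, ∑ i, B.t (op (c i h)) * b i = h := by
  have := hB.1
  have := hB.2
  obtain ⟨n, f, g, -, -, hfg⟩ :=
    Module.Finite.exists_comp_eq_id_of_projective Rᵐᵒᵖ (B.toEnvRing.Res H)
  refine ⟨n, fun i => f (Pi.single i 1), fun i => SkewDual.mk
    (AddMonoidHom.mk' (fun h => (g h i).unop) (fun x y => ?_)) (fun r h => ?_), fun h => ?_⟩
  · exact congrArg (fun z => unop (z i)) (g.map_add x y)
  · exact congrArg (fun z => unop (z i)) (g.map_smul (op r) h)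
  · have h1 : f (g h) = h := LinearMap.congr_fun hfg h
    have h2 : g h = ∑ i, g h i • (Pi.single i 1 : Fin n → Rᵐᵒᵖ) := by
      ext j
      simp [Finset.sum_apply, Pi.single_apply]
    rw [h2, map_sum] at h1
    simp only [map_smul] at h1
    exact h1

/-- The left action of `H` on its skew dual, `(h φ)(g) = φ(g h)`. -/
def translate (h : H) : B.SkewDual →+ B.SkewDual where
  toFun φ := SkewDual.mk ((φ : H →+ R).comp (AddMonoidHom.mulRight h)) (fun r g => by
    change φ (B.t (op r) * g * h) = φ (g * h) * r
    rw [mul_assoc, SkewDual.map_t_mul])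
  map_zero' := rfl
  map_add' _ _ := rfl

@[simp] theorem translate_apply (h : H) (φ : B.SkewDual) (g : H) :
    B.translate h φ g = φ (g * h) := rfl

theorem translate_translate (g h : H) (φ : B.SkewDual) :
    B.translate g (B.translate h φ) = B.translate (g * h) φ :=
  SkewDual.ext fun x => by simp [mul_assoc]

theorem translate_s_mul (r : R) (h : H) (φ : B.SkewDual) :
    B.translate (B.s r * h) φ = B.translate h φ * SkewDual.target r :=
  SkewDual.ext fun x => by rw [SkewDual.mul_target_apply]; simp [mul_assoc]

section Ev

variable {X : Type*} [AddCommGroup X] [Module Rᵐᵒᵖ X]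

/-- The pure tensor of an element of a right `R`-module and an element of the skew dual. -/
def xt (x : X) (φ : B.SkewDual) : BTensor R X (B.dualEnvRing.Res B.SkewDual) :=
  BTensor.tmul R (N := B.dualEnvRing.Res B.SkewDual) x φ

theorem add_xt (x y : X) (φ : B.SkewDual) : B.xt (x + y) φ = B.xt x φ + B.xt y φ :=
  BTensor.add_tmul (N := B.dualEnvRing.Res B.SkewDual) x y φ

theorem zero_xt (φ : B.SkewDual) : B.xt (0 : X) φ = 0 :=
  BTensor.zero_tmul (N := B.dualEnvRing.Res B.SkewDual) φ

theorem xt_sum {n : ℕ} (x : X) (φ : Fin n → B.SkewDual) :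
    B.xt x (∑ i, φ i) = ∑ i, B.xt x (φ i) :=
  map_sum (BTensor.tmulHom (R := R) (N := B.dualEnvRing.Res B.SkewDual) x) φ Finset.univ

theorem xt_smul (r : R) (x : X) (φ : B.SkewDual) :
    B.xt (op r • x) φ = B.xt x (SkewDual.source r * φ) :=
  BTensor.smul_tmul (N := B.dualEnvRing.Res B.SkewDual) r x φ

variable {B} in
@[elab_as_elim]
theorem xt_induction {p : BTensor R X (B.dualEnvRing.Res B.SkewDual) → Prop}
    (z : BTensor R X (B.dualEnvRing.Res B.SkewDual)) (h0 : p 0)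
    (ht : ∀ (x : X) (φ : B.SkewDual), p (B.xt x φ)) (ha : ∀ x y, p x → p y → p (x + y)) : p z :=
  BTensor.induction_on (N := B.dualEnvRing.Res B.SkewDual) z h0 ht ha

/-- For a right `R`-module `X` and `h` in `H`, the map `x ⊗ φ ↦ x · φ(h)`. -/
def ev (h : H) : BTensor R X (B.dualEnvRing.Res B.SkewDual) →+ X :=
  BTensor.lift (N := B.dualEnvRing.Res B.SkewDual)
    (AddMonoidHom.mk' (fun x => AddMonoidHom.mk' (fun φ : B.SkewDual => op (φ h) • x)
        (fun φ φ' : B.SkewDual =>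
          (congrArg (fun a : R => op a • x) (SkewDual.add_apply φ φ' h)).trans
            (add_smul (op (φ h)) (op (φ' h)) x)))
      (fun x x' => by ext φ; exact smul_add _ _ _))
    (fun r x (φ : B.SkewDual) => (smul_smul (op (φ h)) (op r) x).trans
      (congrArg (fun a : R => op a • x) (SkewDual.source_mul_apply r φ h).symm))

theorem ev_xt (h : H) (x : X) (φ : B.SkewDual) : B.ev h (B.xt x φ) = op (φ h) • x := rfl

theorem ev_injective {B : TimesBialgebra k R H} (hB : B.LeftFinite)
    {z z' : BTensor R X (B.dualEnvRing.Res B.SkewDual)} (h : ∀ h, B.ev h z = B.ev h z') :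
    z = z' := by
  obtain ⟨n, b, c, hbc⟩ := hB.exists_dualBasis
  have key : ∀ w : BTensor R X (B.dualEnvRing.Res B.SkewDual),
      ∑ i, B.xt (B.ev (b i) w) (c i) = w := by
    intro w
    induction w using xt_induction with
    | h0 => exact Finset.sum_eq_zero fun i _ => by rw [map_zero, zero_xt]
    | ht x φ =>
      have h1 : ∑ i, SkewDual.source (φ (b i)) * c i = φ := by
        refine SkewDual.ext fun g => ?_
        rw [SkewDual.sum_apply]
        conv_rhs => rw [← hbc g, map_sum]
        exact Finset.sum_congr rfl fun i _ => by
          rw [SkewDual.source_mul_apply, SkewDual.map_t_mul]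
      conv_rhs => rw [← h1, xt_sum]
      exact Finset.sum_congr rfl fun i _ => by rw [ev_xt, xt_smul]
    | ha x y hx hy =>
      conv_rhs => rw [← hx, ← hy]
      rw [← Finset.sum_add_distrib]
      exact Finset.sum_congr rfl fun i _ => by rw [map_add, add_xt]
  rw [← key z, ← key z']
  exact Finset.sum_congr rfl fun i _ => by rw [h]

theorem ev_smul [Module R X] [SMulCommClass R Rᵐᵒᵖ X] (h : H) (r : R)
    (z : BTensor R X (B.dualEnvRing.Res B.SkewDual)) : B.ev h (r • z) = r • B.ev h z := by
  induction z using xt_induction with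
  | h0 => simp
  | ht x φ => exact (smul_comm r (op (φ h)) x).symm
  | ha x y hx hy => simp only [smul_add, map_add, hx, hy]

theorem ev_op_smul (h : H) (r : Rᵐᵒᵖ)
    (z : BTensor R X (B.dualEnvRing.Res B.SkewDual)) :
    B.ev h (r • z) = B.ev (h * B.t r) z := by
  induction z using xt_induction with
  | h0 => simp
  | ht x φ => exact congrArg (fun a : R => op a • x) (SkewDual.target_mul_apply r.unop φ h)
  | ha x y hx hy => simp only [smul_add, map_add, hx, hy]

end Ev

/-- For `h` in `H`, the map `φ ⊗ ψ ↦ t(ψ(h)) φ`, that is, `g ↦ φ(g t(ψ(h)))`. -/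
def evDual (h : H) : B.dualEnvRing.Tens B.SkewDual B.SkewDual →+ B.SkewDual :=
  B.ev (X := B.dualEnvRing.Res B.SkewDual) h

theorem evDual_tp (h : H) (φ ψ : B.SkewDual) :
    B.evDual h (B.dualEnvRing.tp φ ψ) = SkewDual.target (ψ h) * φ := rfl

theorem evDual_injective {B : TimesBialgebra k R H} (hB : B.LeftFinite)
    {z z' : B.dualEnvRing.Tens B.SkewDual B.SkewDual} (h : ∀ h, B.evDual h z = B.evDual h z') :
    z = z' := ev_injective hB h

theorem evDual_smul (h : H) (r : R) (z : B.dualEnvRing.Tens B.SkewDual B.SkewDual) :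
    B.evDual h (r • z) = SkewDual.source r * B.evDual h z := B.ev_smul h r z

theorem evDual_op_smul (h : H) (r : Rᵐᵒᵖ) (z : B.dualEnvRing.Tens B.SkewDual B.SkewDual) :
    B.evDual h (r • z) = B.evDual (h * B.t r) z := B.ev_op_smul h r z

theorem evDual_evalAt_left (h : H) (α : B.SkewDual)
    (z : B.dualEnvRing.Tens B.SkewDual B.SkewDual) :
    B.evDual h (B.dualEnvRing.evalAt α (1 : B.SkewDual) z) = B.evDual h z * α := by
  induction z using EnvRing.tens_induction with
  | h0 => simp
  | ht φ ψ => simp [evDual_tp, mul_assoc]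
  | ha x y hx hy => simp only [map_add, hx, hy, add_mul]

theorem evDual_evalAt_source (h : H) (r : R) (z : B.dualEnvRing.Tens B.SkewDual B.SkewDual) :
    B.evDual h (B.dualEnvRing.evalAt (1 : B.SkewDual) (SkewDual.source r : B.SkewDual) z) =
      B.evDual (B.s r * h) z := by
  induction z using EnvRing.tens_induction with
  | h0 => simp
  | ht φ ψ => simp [evDual_tp, SkewDual.mul_source_apply]
  | ha x y hx hy => simp only [map_add, hx, hy]

theorem LeftFinite.existsUnique_comul {B : TimesBialgebra k R H} (hB : B.LeftFinite)
    (φ : B.SkewDual) : ∃! z : B.dualEnvRing.Tens B.SkewDual B.SkewDual,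
      ∀ h, B.evDual h z = B.translate h φ := by
  obtain ⟨n, b, c, hbc⟩ := hB.exists_dualBasis
  refine ⟨∑ i, B.dualEnvRing.tp (B.translate (b i) φ) (c i), fun h => ?_,
    fun z hz => evDual_injective hB fun h => ?_⟩
  all_goals
    have key : B.evDual h (∑ i, B.dualEnvRing.tp (B.translate (b i) φ) (c i)) = B.translate h φ := by
      rw [map_sum]
      refine SkewDual.ext fun g => ?_
      rw [SkewDual.sum_apply]
      conv_rhs => rw [← hbc h, translate_apply, Finset.mul_sum, map_sum]
      refine Finset.sum_congr rfl fun i _ => ?_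
      rw [evDual_tp, SkewDual.target_mul_apply, translate_apply, mul_assoc]
  · exact key
  · exact (hz h).trans key.symm

/-- The comultiplication of the skew dual: `∑ φ₁ ⊗ φ₂` is the unique element such that
`∑ φ₁(g t(φ₂(h))) = φ(g h)` for all `g` and `h` in `H`. -/
noncomputable def dualComul {B : TimesBialgebra k R H} (hB : B.LeftFinite) :
    B.SkewDual →+ B.dualEnvRing.Tens B.SkewDual B.SkewDual :=
  AddMonoidHom.mk' (fun φ => (hB.existsUnique_comul φ).choose) (fun φ ψ =>
    evDual_injective hB fun h => by
      rw [map_add, (hB.existsUnique_comul φ).choose_spec.1,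
        (hB.existsUnique_comul ψ).choose_spec.1, (hB.existsUnique_comul (φ + ψ)).choose_spec.1,
        map_add])

theorem evDual_dualComul {B : TimesBialgebra k R H} (hB : B.LeftFinite) (h : H) (φ : B.SkewDual) :
    B.evDual h (dualComul hB φ) = B.translate h φ := (hB.existsUnique_comul φ).choose_spec.1 h

/-- The counit `φ ↦ φ(1)` of the skew dual. -/
def dualCounit : B.SkewDual →+ R := SkewDual.apply 1

theorem dualCounit_apply (φ : B.SkewDual) : B.dualCounit φ = φ 1 := rfl

theorem dualCounit_source_mul (r : R) (φ : B.SkewDual) :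
    B.dualCounit (B.dualEnvRing.s r * φ) = r * B.dualCounit φ :=
  SkewDual.source_mul_apply r φ 1

theorem dualCounit_target_mul (r : R) (φ : B.SkewDual) :
    B.dualCounit (B.dualEnvRing.t (op r) * φ) = B.dualCounit φ * r :=
  (SkewDual.target_mul_apply r φ 1).trans (by
    rw [one_mul, ← mul_one (B.t (op r)), SkewDual.map_t_mul]; rfl)

theorem dualComul_source_mul {B : TimesBialgebra k R H} (hB : B.LeftFinite) (r : R)
    (φ : B.SkewDual) : dualComul hB (B.dualEnvRing.s r * φ) = r • dualComul hB φ :=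
  evDual_injective hB fun h => by
    rw [evDual_dualComul, evDual_smul, evDual_dualComul]
    refine SkewDual.ext fun g => ?_
    rw [SkewDual.source_mul_apply]
    exact SkewDual.source_mul_apply r φ (g * h)

theorem dualComul_target_mul {B : TimesBialgebra k R H} (hB : B.LeftFinite) (r : Rᵐᵒᵖ)
    (φ : B.SkewDual) : dualComul hB (B.dualEnvRing.t r * φ) = r • dualComul hB φ :=
  evDual_injective hB fun h => by
    rw [evDual_dualComul, evDual_op_smul, evDual_dualComul]
    refine SkewDual.ext fun g => ?_
    rw [translate_apply, translate_apply, ← mul_assoc]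
    exact SkewDual.target_mul_apply r.unop φ (g * h)

theorem dualCounit_left (z : B.dualEnvRing.Tens B.SkewDual B.SkewDual) (h : H) :
    B.dualEnvRing.counitLeft B.dualCounit B.dualCounit_target_mul z h = B.evDual h z 1 := by
  induction z using EnvRing.tens_induction with
  | h0 => simp
  | ht φ ψ =>
    rw [EnvRing.counitLeft_tp, evDual_tp, SkewDual.target_mul_apply, one_mul,
      ← mul_one (B.t _), SkewDual.map_t_mul]
    exact SkewDual.source_mul_apply (φ 1) ψ h
  | ha x y hx hy => simp only [map_add, SkewDual.add_apply, hx, hy]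

theorem dualCounit_right (z : B.dualEnvRing.Tens B.SkewDual B.SkewDual) :
    B.dualEnvRing.counitRight B.dualCounit B.dualCounit_source_mul z = B.evDual 1 z := by
  induction z using EnvRing.tens_induction with
  | h0 => simp
  | ht φ ψ => rfl
  | ha x y hx hy => simp only [map_add, hx, hy]

theorem ev_map_dualComul {B : TimesBialgebra k R H} (hB : B.LeftFinite) (h : H)
    (z : B.dualEnvRing.Tens B.SkewDual B.SkewDual) :
    B.ev (X := B.dualEnvRing.Tens B.SkewDual B.SkewDual) h
      (BTensor.map (M := B.dualEnvRing.Res B.SkewDual) (dualComul hB)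
        (AddMonoidHom.id (B.dualEnvRing.Res B.SkewDual))
        (fun r φ => dualComul_target_mul hB (op r) φ) (fun _ _ => rfl) z) =
      dualComul hB (B.evDual h z) := by
  induction z using EnvRing.tens_induction with
  | h0 => simp
  | ht φ ψ => exact (dualComul_target_mul hB (op (ψ h)) φ).symm
  | ha x y hx hy => simp only [map_add, hx, hy]

theorem ev_assocInv (h : H) (w : BTensor R (B.dualEnvRing.Res B.SkewDual)
      (B.dualEnvRing.Tens B.SkewDual B.SkewDual)) :
    B.ev (X := B.dualEnvRing.Tens B.SkewDual B.SkewDual) h (BTensor.assocInv w) =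
      BTensor.map (N' := B.dualEnvRing.Res B.SkewDual)
        (AddMonoidHom.id (B.dualEnvRing.Res B.SkewDual)) (B.evDual h)
        (fun _ _ => rfl) (fun r z => B.evDual_smul h r z) w := by
  induction w using BTensor.induction_on with
  | h0 => simp
  | ht φ z =>
    induction z using EnvRing.tens_induction with
    | h0 => simp [BTensor.tmul_zero]
    | ht ψ χ => rfl
    | ha x y hx hy => rw [BTensor.tmul_add]; simp only [map_add, hx, hy]
  | ha x y hx hy => simp only [map_add, hx, hy]

theorem evDual_map_map {B : TimesBialgebra k R H} (hB : B.LeftFinite) (g h : H)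
    (z : B.dualEnvRing.Tens B.SkewDual B.SkewDual) :
    B.evDual g (BTensor.map (N' := B.dualEnvRing.Res B.SkewDual)
        (AddMonoidHom.id (B.dualEnvRing.Res B.SkewDual)) (B.evDual h)
        (fun _ _ => rfl) (fun r z => B.evDual_smul h r z)
        (BTensor.map (N := B.dualEnvRing.Res B.SkewDual)
          (AddMonoidHom.id (B.dualEnvRing.Res B.SkewDual)) (dualComul hB)
          (fun _ _ => rfl) (dualComul_source_mul hB) z)) =
      B.evDual (g * h) z := by
  induction z using EnvRing.tens_induction with
  | h0 => simp
  | ht φ ψ =>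
    change SkewDual.target (B.evDual h (dualComul hB ψ) g) * φ = SkewDual.target (ψ (g * h)) * φ
    rw [evDual_dualComul, translate_apply]
  | ha x y hx hy => simp only [map_add, hx, hy]

theorem dualCoassoc {B : TimesBialgebra k R H} (hB : B.LeftFinite) (φ : B.SkewDual) :
    BTensor.assoc (BTensor.map (M := B.dualEnvRing.Res B.SkewDual) (dualComul hB)
        (AddMonoidHom.id (B.dualEnvRing.Res B.SkewDual))
        (fun r φ => dualComul_target_mul hB (op r) φ) (fun _ _ => rfl) (dualComul hB φ)) =
      BTensor.map (N := B.dualEnvRing.Res B.SkewDual)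
          (AddMonoidHom.id (B.dualEnvRing.Res B.SkewDual)) (dualComul hB)
          (fun _ _ => rfl) (dualComul_source_mul hB) (dualComul hB φ) := by
  refine Eq.trans ?_ (BTensor.assoc_assocInv _)
  refine congrArg BTensor.assoc (ev_injective hB fun h => ?_)
  rw [ev_map_dualComul, ev_assocInv]
  refine evDual_injective hB fun g => ?_
  rw [evDual_map_map, evDual_dualComul, evDual_dualComul, evDual_dualComul, translate_translate]

theorem dualComul_mem {B : TimesBialgebra k R H} (hB : B.LeftFinite) (φ : B.SkewDual) :
    dualComul hB φ ∈ B.dualEnvRing.takeuchi := fun r =>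
  evDual_injective hB fun h => by
    refine (B.evDual_evalAt_left h _ _).trans (Eq.trans ?_ (B.evDual_evalAt_source h r _).symm)
    rw [evDual_dualComul, evDual_dualComul, translate_s_mul]
    rfl

theorem evDual_one_tp_one (h : H) :
    B.evDual h (B.dualEnvRing.tp 1 1) = B.translate h 1 := SkewDual.ext fun g => by
  rw [evDual_tp, SkewDual.target_mul_apply, translate_apply]
  exact B.counit_mul_t g h

theorem evDual_evalAt {B : TimesBialgebra k R H} (hB : B.LeftFinite) (φ α β : B.SkewDual)
    {n : ℕ} (a b : Fin n → H) (h : H) (hh : B.comul h = ∑ i, B.toEnvRing.tp (a i) (b i)) :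
    B.evDual h (B.dualEnvRing.evalAt α β (dualComul hB φ)) =
      ∑ i, B.translate (b i) φ * B.evDual (a i) (B.dualEnvRing.tp α β) := by
  have key : ∀ z, B.evDual h (B.dualEnvRing.evalAt α β z) =
      ∑ i, B.evDual (B.s (β (a i)) * b i) z * α := by
    intro z
    induction z using EnvRing.tens_induction with
    | h0 => simp
    | ht φ ψ =>
      refine SkewDual.ext fun g => ?_
      simp only [EnvRing.evalAt_tp, evDual_tp, smul_eq_mul, SkewDual.sum_apply, mul_assoc,
        SkewDual.target_mul_apply]
      rw [SkewDual.mul_apply ψ, hh]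
      simp only [map_sum, SkewDual.conv_tp]
      rw [Finset.op_sum, map_sum, Finset.mul_sum, map_sum]
    | ha x y hx hy => simp only [map_add, hx, hy, add_mul, Finset.sum_add_distrib]
  rw [key]
  refine Finset.sum_congr rfl fun i _ => ?_
  rw [evDual_dualComul, translate_s_mul, mul_assoc, evDual_tp]

theorem _root_.EnvRing.exists_sum_tp (E : EnvRing k R H) {M N : Type*} [AddCommGroup M]
    [Module H M] [AddCommGroup N] [Module H N] (z : E.Tens M N) :
    ∃ (n : ℕ) (a : Fin n → M) (b : Fin n → N), z = ∑ i, E.tp (a i) (b i) := by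
  induction z using EnvRing.tens_induction with
  | h0 => exact ⟨0, Fin.elim0, Fin.elim0, by simp⟩
  | ht m n => exact ⟨1, fun _ => m, fun _ => n, by simp⟩
  | ha x y hx hy =>
    obtain ⟨n, a, b, rfl⟩ := hx
    obtain ⟨n', a', b', rfl⟩ := hy
    exact ⟨n + n', Fin.append a a', Fin.append b b', by simp [Fin.sum_univ_add]⟩

theorem conv_evalAt (φ ψ : B.SkewDual) (a b : H) (z : B.toEnvRing.Tens H H) :
    SkewDual.conv φ ψ (B.toEnvRing.evalAt a b z) =
      SkewDual.conv (B.translate b φ) (B.translate a ψ) z := by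
  induction z using EnvRing.tens_induction with
  | h0 => simp
  | ht g h => simp [mul_assoc]
  | ha x y hx hy => simp only [map_add, hx, hy]

theorem dualComul_mul {B : TimesBialgebra k R H} (hB : B.LeftFinite) (φ ψ : B.SkewDual) :
    dualComul hB (φ * ψ) = EnvRing.act (M := B.SkewDual) (N := B.SkewDual)
      (dualComul_mem hB φ) (dualComul hB ψ) := by
  refine evDual_injective hB fun h => ?_
  obtain ⟨n, a, b, hh⟩ := B.toEnvRing.exists_sum_tp (B.comul h)
  have key : ∀ w : B.dualEnvRing.Tens B.SkewDual B.SkewDual,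
      B.evDual h (EnvRing.act (dualComul_mem hB φ) w) =
        ∑ i, B.translate (b i) φ * B.evDual (a i) w := by
    intro w
    induction w using EnvRing.tens_induction with
    | h0 => simp
    | ht α β => rw [EnvRing.act_tp, evDual_evalAt hB φ α β a b h hh]
    | ha x y hx hy => simp only [map_add, hx, hy, mul_add, Finset.sum_add_distrib]
  rw [key, evDual_dualComul]
  refine SkewDual.ext fun g => ?_
  rw [SkewDual.sum_apply, translate_apply, SkewDual.mul_apply, B.comul_mul, hh, map_sum, map_sum]
  refine Finset.sum_congr rfl fun i _ => ?_
  rw [EnvRing.act_tp, conv_evalAt, evDual_dualComul, SkewDual.mul_apply]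

/-- The left skew dual `H^∨ = Hom_{R̄-}(H, R)` of a left finite `×_R`-bialgebra `H`, as a
`×_R`-bialgebra: the bialgebroid structure for which a left `H`-comodule `M` is an `H^∨`-module
by `φ m = ∑ φ(m₍₋₁₎) m₍₀₎`, compatibly with tensor products and underlying bimodules. -/
noncomputable def skewDual (hB : B.LeftFinite) : TimesBialgebra k R B.SkewDual where
  toEnvRing := B.dualEnvRing
  comul := dualComul hB
  counit := B.dualCounit
  comul_s_mul := dualComul_source_mul hB
  comul_t_mul := dualComul_target_mul hB
  counit_s_mul := B.dualCounit_source_mul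
  counit_t_mul := B.dualCounit_target_mul
  coassoc := dualCoassoc hB
  counit_comul φ := SkewDual.ext fun h => by
    rw [dualCounit_left, evDual_dualComul, translate_apply, one_mul]
  comul_counit φ := SkewDual.ext fun h => by
    rw [dualCounit_right, evDual_dualComul, translate_apply, mul_one]
  comul_mem := dualComul_mem hB
  comul_one := evDual_injective hB fun h => by rw [evDual_dualComul, evDual_one_tp_one]
  comul_mul := dualComul_mul hB
  counit_one := B.counit_one
  counit_mul_s φ ψ := by
    refine (SkewDual.mul_source_apply (ψ 1) φ 1).trans ?_
    rw [dualCounit_apply, SkewDual.mul_apply, B.comul_one, SkewDual.conv_tp]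
  counit_mul_t φ ψ := by
    refine (SkewDual.mul_target_apply (ψ 1) φ 1).trans ?_
    rw [dualCounit_apply, SkewDual.mul_apply, B.comul_one, SkewDual.conv_tp, one_mul, mul_one]

/-- The pairing that determines the comultiplication of the skew dual: if
`Δ(φ) = ∑ φᵢ ⊗ ψᵢ`, then `φ(g h) = ∑ φᵢ(g t(ψᵢ(h)))`. -/
theorem skewDual_comul_spec (hB : B.LeftFinite) {n : ℕ} (φ : B.SkewDual)
    (a b : Fin n → B.SkewDual)
    (h : (B.skewDual hB).comul φ = ∑ i, (B.skewDual hB).toEnvRing.tp (a i) (b i)) (x y : H) :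
    φ (x * y) = ∑ i, a i (x * B.t (op (b i y))) := by
  have h1 : B.translate y φ = ∑ i, B.evDual y (B.dualEnvRing.tp (a i) (b i)) :=
    (evDual_dualComul hB y φ).symm.trans ((congrArg (B.evDual y) h).trans
      (map_sum (B.evDual y) (fun i => B.dualEnvRing.tp (a i) (b i)) Finset.univ))
  rw [← translate_apply, h1, SkewDual.sum_apply]
  exact Finset.sum_congr rfl fun i _ => SkewDual.target_mul_apply _ _ _

end Dual

end TimesBialgebra

namespace TimesBialgebra

/-- A `×_R`-bialgebra is a `×_R`-anti-Hopf algebra if its coopposite is a `×_{Rᵐᵒᵖ}`-Hopf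
algebra. -/
def IsAntiHopf {k : Type v} {R H : Type u} [CommRing k] [Ring R] [Algebra k R] [Ring H]
    [Algebra k H] (B : TimesBialgebra k R H) : Prop :=
  B.coop.IsHopf

end TimesBialgebra

/-! The Hopf condition is equivalent to bijectivity of a single map, the Galois map `β : H ⊗_{R̄} H
→ H ⊗_R H`, `g ⊗ h ↦ ∑ g₁ ⊗ g₂ h`. The theorem then follows because the Galois map of the coopposite
of `H^∨` is the transpose of `β`.

Hopf condition and Galois map. In the category of `H`-modules a right inner hom always exists,
namely `Hom_H(H ⊗_R M, N)`. For bimodules it is `Hom_{R̄}(M, N)`, which is `Hom_H(H ⊗_{R̄} M, N)` by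
induction along `t`. The comparison map restricts along `m ↦ 1 ⊗ m`, that is, it composes with `β_M
: H ⊗_{R̄} M → H ⊗_R M`. So preservation of inner homs amounts to an extension property: every
`R̄`-linear `M → N` extends uniquely along `m ↦ 1 ⊗ m` to an `H`-linear map `H ⊗_R M → N`
(`IsHopf.existsUnique_extension`). Applied to `M = H` this inverts `β` (`IsHopf.bijective_galois`).
Conversely, an inverse of `β_H` yields one of every `β_M` (`bijective_galois_module`), hence the
extension property and the Hopf condition (`isHopf_of_bijective_galois`).

Duality. Write `H^∨ ⊗ H^∨` for the tensor product with `φ s(r) ⊗ ψ = φ ⊗ s(r) ψ`. Left finiteness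
identifies it with the `R̄`-linear functionals on `H ⊗_R H`, through `φ ⊗ ψ ↦ (g ⊗ h ↦ φ(s(ψ(g))
h))` (`LeftFinite.convInd_injective`, `LeftFinite.exists_convInd_eq`). It also embeds `H^∨ ⊗_R H^∨`
into the functionals on `H ⊗_{R̄} H`, through `φ ⊗ ψ ↦ (g ⊗ h ↦ φ(g t(ψ(h))))` (`evDual_injective`).
Under these identifications `φ ⊗ ψ ↦ ∑ φ₁ ψ ⊗ φ₂` becomes composition with `β`
(`evDual_dualGalois`), so it is bijective when `β` is (`bijective_dualGalois`). -/

namespace EnvRing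

/-! ### Modules induced along the target map. -/

section Induction

variable {k R H : Type*} [CommRing k] [Ring R] [Algebra k R] [Ring H] [Algebra k H]
  (E : EnvRing k R H)

/-- The relations `t(r) ⊗ m - 1 ⊗ t(r) m` that define the induced module `H ⊗_{Rᵐᵒᵖ} M`. -/
def indRel (M : Type*) [AddCommGroup M] [Module H M] : Submodule H (H ⊗[ℤ] M) :=
  Submodule.span H {z | ∃ (r : Rᵐᵒᵖ) (m : M), z = E.t r ⊗ₜ[ℤ] m - (1 : H) ⊗ₜ[ℤ] (E.t r • m)}

/-- The induced module `H ⊗_{Rᵐᵒᵖ} M`, with `h t(r) ⊗ m = h ⊗ t(r) m`. -/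
def Ind (M : Type*) [AddCommGroup M] [Module H M] : Type _ := (H ⊗[ℤ] M) ⧸ E.indRel M

section Basic

variable (M : Type*) [AddCommGroup M] [Module H M]

instance : AddCommGroup (E.Ind M) := inferInstanceAs (AddCommGroup ((H ⊗[ℤ] M) ⧸ E.indRel M))

instance : Module H (E.Ind M) := inferInstanceAs (Module H ((H ⊗[ℤ] M) ⧸ E.indRel M))

end Basic

variable {M : Type*} [AddCommGroup M] [Module H M] {N : Type*} [AddCommGroup N] [Module H N]
  {P : Type*} [AddCommGroup P]

variable (M) in
/-- The projection `H ⊗_ℤ M → H ⊗_{Rᵐᵒᵖ} M`. -/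
def indMk : H ⊗[ℤ] M →ₗ[H] E.Ind M := (E.indRel M).mkQ

/-- The pure tensor `h ⊗ m` in `H ⊗_{Rᵐᵒᵖ} M`. -/
def itp (h : H) (m : M) : E.Ind M := E.indMk M (h ⊗ₜ[ℤ] m)

theorem itp_add (h : H) (m m' : M) : E.itp h (m + m') = E.itp h m + E.itp h m' := by
  unfold itp
  rw [TensorProduct.tmul_add, map_add]

theorem add_itp (h h' : H) (m : M) : E.itp (h + h') m = E.itp h m + E.itp h' m := by
  unfold itp
  rw [TensorProduct.add_tmul, map_add]

theorem smul_itp (g h : H) (m : M) : g • E.itp h m = E.itp (g * h) m := by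
  unfold itp
  rw [← map_smul, TensorProduct.smul_tmul', smul_eq_mul]

/-- The generating relations have first factor `t(r)` or `1` only; the general balancing relation is
their left multiple by `h`, available because they span an `H`-submodule. -/
theorem itp_t (h : H) (r : Rᵐᵒᵖ) (m : M) : E.itp (h * E.t r) m = E.itp h (E.t r • m) := by
  have h1 : E.itp (E.t r) m = E.itp 1 (E.t r • m) := by
    rw [← sub_eq_zero]
    unfold itp
    rw [← map_sub]
    exact (Submodule.Quotient.mk_eq_zero _).2 (Submodule.subset_span ⟨r, m, rfl⟩)
  rw [← smul_itp, h1, smul_itp, mul_one]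

/-- Pure tensors, as a biadditive map. -/
def itpHom : H →+ M →+ E.Ind M :=
  AddMonoidHom.mk' (fun h => AddMonoidHom.mk' (fun m => E.itp h m) (E.itp_add h))
    (fun h h' => by ext m; exact E.add_itp h h' m)

theorem zero_itp (m : M) : E.itp 0 m = 0 := map_zero (E.itpHom.flip m)

theorem itp_sum {ι : Type*} (S : Finset ι) (h : H) (m : ι → M) :
    E.itp h (∑ i ∈ S, m i) = ∑ i ∈ S, E.itp h (m i) := map_sum (E.itpHom h) m S

variable {E} in
@[elab_as_elim]
theorem ind_induction {p : E.Ind M → Prop} (z : E.Ind M) (h0 : p 0)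
    (ht : ∀ (h : H) (m : M), p (E.itp h m)) (ha : ∀ x y, p x → p y → p (x + y)) : p z := by
  obtain ⟨z, rfl⟩ : ∃ x, E.indMk M x = z := (E.indRel M).mkQ_surjective z
  induction z using TensorProduct.induction_on with
  | zero => rw [map_zero]; exact h0
  | tmul h m => exact ht h m
  | add x y hx hy => rw [map_add]; exact ha _ _ hx hy

/-- Additive maps out of `H ⊗_{Rᵐᵒᵖ} M` from balanced biadditive maps. -/
def indLiftAdd (f : H →+ M →+ P) (hf : ∀ h r m, f (h * E.t r) m = f h (E.t r • m)) :
    E.Ind M →+ P :=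
  QuotientAddGroup.lift (E.indRel M).toAddSubgroup
    (TensorProduct.liftAddHom f (fun z m n => by rw [map_zsmul]; simp)) (fun x hx => by
      -- The relations form an `H`-span while `f` is merely additive, so the induction needs
      -- vanishing on all multiples `g • x` at once; the case `g = 1` is what is wanted.
      have key : ∀ g : H,
          TensorProduct.liftAddHom f (fun (z : ℤ) m n => by rw [map_zsmul]; simp) (g • x) = 0 := by
        refine Submodule.span_induction ?_ ?_ ?_ ?_ hx
        · rintro _ ⟨r, m, rfl⟩ g
          simp [smul_sub, TensorProduct.smul_tmul', hf]
        · simp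
        · intro x y _ _ hx hy g
          rw [smul_add, map_add, hx, hy, add_zero]
        · intro a x _ hx g
          rw [smul_smul, hx]
      simpa using key 1)

/-- An additive map out of `H ⊗_{Rᵐᵒᵖ} M` that is `H`-linear on pure tensors is `H`-linear. -/
def indLinear (f : E.Ind M →+ N) (hf : ∀ (g h : H) (m : M), f (g • E.itp h m) = g • f (E.itp h m)) :
    E.Ind M →ₗ[H] N where
  __ := f
  map_smul' g z := by
    change f (g • z) = g • f z
    induction z using ind_induction with
    | h0 => simp
    | ht h m => exact hf g h m
    | ha x y hx hy => rw [smul_add, map_add, map_add, smul_add, hx, hy]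

/-- The `H`-linear map `h ⊗ m ↦ h f(m)` induced by a map `f` that commutes with the action of
`Rᵐᵒᵖ`. -/
def indLift (f : M →+ N) (hf : ∀ r m, f (E.t r • m) = E.t r • f m) : E.Ind M →ₗ[H] N :=
  E.indLinear (E.indLiftAdd
    (AddMonoidHom.mk' (fun h => (DistribSMul.toAddMonoidHom N h).comp f)
      (fun h h' => by ext m; exact add_smul h h' (f m)))
    (fun h r m => by
      change (h * E.t r) • f m = h • f (E.t r • m)
      rw [hf, mul_smul]))
    (fun g h m => by
      rw [smul_itp]
      exact mul_smul g h (f m))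

@[simp] theorem indLift_itp (f : M →+ N) (hf) (h : H) (m : M) :
    E.indLift f hf (E.itp h m) = h • f m := rfl

theorem ind_hom_ext {f g : E.Ind M →ₗ[H] N} (h : ∀ m, f (E.itp 1 m) = g (E.itp 1 m)) : f = g := by
  ext z
  induction z using ind_induction with
  | h0 => simp
  | ht a m => rw [← mul_one a, ← smul_itp, map_smul, map_smul, h]
  | ha x y hx hy => rw [map_add, map_add, hx, hy]

end Induction

end EnvRing

namespace TimesBialgebra

/-! ### Tensor products of modules and the Galois map. -/

section Galois

variable {k R H : Type*} [CommRing k] [Ring R] [Algebra k R] [Ring H] [Algebra k H]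
  (B : TimesBialgebra k R H)

section Tensor

variable {M N X X' : Type*} [AddCommGroup M] [Module H M] [AddCommGroup N] [Module H N]
  [AddCommGroup X] [Module H X] [AddCommGroup X'] [Module H X']

/-- The pure tensor `m ⊗ n` in the `H`-module `M ⊗_R N`. -/
def tt (m : M) (n : N) : B.Tensor M N := B.tensorEquiv M N (B.toEnvRing.tp m n)

theorem tt_add (m : M) (n n' : N) : B.tt m (n + n') = B.tt m n + B.tt m n' :=
  B.toEnvRing.tp_add m n n'

theorem add_tt (m m' : M) (n : N) : B.tt (m + m') n = B.tt m n + B.tt m' n :=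
  B.toEnvRing.add_tp m m' n

theorem tt_smul (r : R) (m : M) (n : N) : B.tt (B.t (op r) • m) n = B.tt m (B.s r • n) :=
  B.toEnvRing.tp_smul r m n

theorem s_smul_tt (r : R) (m : M) (n : N) : B.s r • B.tt m n = B.tt (B.s r • m) n :=
  (B.tensorEquiv_smul r (B.toEnvRing.tp m n)).symm

theorem t_smul_tt (r : Rᵐᵒᵖ) (m : M) (n : N) : B.t r • B.tt m n = B.tt m (B.t r • n) :=
  (B.tensorEquiv_op_smul r (B.toEnvRing.tp m n)).symm

theorem smul_tt (h : H) (m : M) (n : N) :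
    h • B.tt m n = B.tensorEquiv M N (B.toEnvRing.evalAt m n (B.comul h)) := rfl

variable {B} in
@[elab_as_elim]
theorem tt_induction {p : B.Tensor M N → Prop} (z : B.Tensor M N) (h0 : p 0)
    (ht : ∀ (m : M) (n : N), p (B.tt m n)) (ha : ∀ x y, p x → p y → p (x + y)) : p z :=
  EnvRing.tens_induction (E := B.toEnvRing) (M := M) (N := N) z h0 ht ha

theorem tensor_hom_ext {f g : B.Tensor M N →ₗ[H] X} (h : ∀ m n, f (B.tt m n) = g (B.tt m n)) :
    f = g := by
  ext z
  induction z using tt_induction with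
  | h0 => simp
  | ht m n => exact h m n
  | ha x y hx hy => rw [map_add, map_add, hx, hy]

/-- An additive map out of `M ⊗_R N` that is `H`-linear on pure tensors is `H`-linear. -/
def tensorLinear (f : B.Tensor M N →+ X)
    (hf : ∀ (h : H) (m : M) (n : N), f (h • B.tt m n) = h • f (B.tt m n)) :
    B.Tensor M N →ₗ[H] X where
  __ := f
  map_smul' g z := by
    change f (g • z) = g • f z
    induction z using tt_induction with
    | h0 => simp
    | ht m n => exact hf g m n
    | ha x y hx hy => rw [smul_add, map_add, map_add, smul_add, hx, hy]

/-- The additive map `u ⊗ M` for an `H`-linear map `u`. -/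
def rTensorAdd (u : X →ₗ[H] X') : B.toEnvRing.Tens X M →+ B.toEnvRing.Tens X' M :=
  B.toEnvRing.lift (M := X) (N := M)
    (AddMonoidHom.mk' (fun x => AddMonoidHom.mk' (fun m => B.toEnvRing.tp (u x) m)
        (B.toEnvRing.tp_add (u x)))
      (fun x x' => by ext m; simp [EnvRing.add_tp]))
    (fun r x m => by simp [EnvRing.tp_smul])

/-- For `w = Δ(h)` this is the `H`-linearity of `u ⊗ M` on pure tensors. A general `w` allows
induction on `w`. -/
theorem rTensorAdd_evalAt (u : X →ₗ[H] X') (x : X) (m : M) (w : B.toEnvRing.Tens H H) :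
    B.rTensorAdd u (B.toEnvRing.evalAt x m w) = B.toEnvRing.evalAt (u x) m w := by
  induction w using EnvRing.tens_induction with
  | h0 => simp
  | ht a b => exact congrArg (B.toEnvRing.tp · (b • m)) (map_smul u a x)
  | ha x y hx hy => simp only [map_add, hx, hy]

/-- The `H`-linear map `u ⊗ M` for an `H`-linear map `u`. -/
def rTensor (u : X →ₗ[H] X') : B.Tensor X M →ₗ[H] B.Tensor X' M :=
  B.tensorLinear (((B.tensorEquiv X' M).toAddMonoidHom.comp (B.rTensorAdd u)).comp
    (B.tensorEquiv X M).symm.toAddMonoidHom) (fun h x m => B.rTensorAdd_evalAt u x m (B.comul h))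

end Tensor

variable (M : Type*) [AddCommGroup M] [Module H M] (N : Type*) [AddCommGroup N] [Module H N]

/-- The Galois map `H ⊗_{Rᵐᵒᵖ} M → H ⊗_R M`, `h ⊗ m ↦ ∑ h₁ ⊗ h₂ m`. -/
def galois : B.toEnvRing.Ind M →ₗ[H] B.Tensor H M :=
  B.toEnvRing.indLift (AddMonoidHom.mk' (fun m => B.tt (1 : H) m) (B.tt_add 1))
    (fun r m => (B.t_smul_tt r 1 m).symm)

variable {M N}

theorem galois_itp (h : H) (m : M) : B.galois M (B.toEnvRing.itp h m) = h • B.tt (1 : H) m := rfl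

/-- For `m` in `M`, the map `H ⊗_{Rᵐᵒᵖ} H → H ⊗_{Rᵐᵒᵖ} M`, `g ⊗ h ↦ g ⊗ h m`. -/
def indMulRight (m : M) : B.toEnvRing.Ind H →ₗ[H] B.toEnvRing.Ind M :=
  B.toEnvRing.indLift (AddMonoidHom.mk' (fun h : H => B.toEnvRing.itp 1 (h • m))
      (fun h h' => by rw [add_smul, EnvRing.itp_add]))
    (fun r h => by
      change B.toEnvRing.itp 1 ((B.t r * h) • m) = _ • B.toEnvRing.itp 1 (h • m)
      rw [mul_smul, ← EnvRing.itp_t, EnvRing.smul_itp, one_mul, mul_one])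

theorem indMulRight_itp (m : M) (g h : H) :
    B.indMulRight m (B.toEnvRing.itp g h) = B.toEnvRing.itp g (h • m) := by
  change g • B.toEnvRing.itp 1 (h • m) = _
  rw [EnvRing.smul_itp, mul_one]

theorem indMulRight_indMulRight (m : M) (h : H) (z : B.toEnvRing.Ind H) :
    B.indMulRight m (B.indMulRight h z) = B.indMulRight (h • m) z := by
  induction z using EnvRing.ind_induction with
  | h0 => simp
  | ht a b => rw [indMulRight_itp, indMulRight_itp, indMulRight_itp, smul_eq_mul, mul_smul]
  | ha x y hx hy => simp only [map_add, hx, hy]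

/-- The Galois map is natural with respect to letting the second factor act on `m`, since `∑ h₁ ⊗ h₂
(h' m) = ∑ h₁ ⊗ (h₂ h') m`. Thus `β_H` controls `β_M` for every `M`. -/
theorem galois_indMulRight (m : M) (z : B.toEnvRing.Ind H) :
    B.galois M (B.indMulRight m z) = B.tensorEquiv H M
      (B.toEnvRing.evalAt 1 m ((B.tensorEquiv H H).symm (B.galois H z))) := by
  induction z using EnvRing.ind_induction with
  | h0 => simp
  | ht g h =>
    rw [indMulRight_itp, galois_itp, galois_itp, smul_tt, smul_tt, AddEquiv.symm_apply_apply,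
      EnvRing.evalAt_smul_right]
  | ha x y hx hy => simp only [map_add, hx, hy]

end Galois

end TimesBialgebra

namespace TimesBialgebra

/-! ### The right inner hom of the category of modules. -/

section InnerHom

variable {k R H : Type*} [CommRing k] [Ring R] [Algebra k R] [Ring H] [Algebra k H]
  (B : TimesBialgebra k R H) (M N : Type*) [AddCommGroup M] [Module H M] [AddCommGroup N]
  [Module H N]

/-- The right inner hom `Hom_H(H ⊗_R M, N)` of the category of `H`-modules. -/
def InnerHom : Type _ := B.Tensor H M →ₗ[H] N

namespace InnerHom

instance : AddCommGroup (B.InnerHom M N) := inferInstanceAs (AddCommGroup (B.Tensor H M →ₗ[H] N))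

variable {M N}

/-- The underlying linear map of an element of the inner hom. -/
def toHom (p : B.InnerHom M N) : B.Tensor H M →ₗ[H] N := p

variable {B}

theorem ext {p q : B.InnerHom M N} (h : ∀ g m, p.toHom B (B.tt g m) = q.toHom B (B.tt g m)) :
    p = q :=
  B.tensor_hom_ext h

theorem toHom_add (p q : B.InnerHom M N) : (p + q).toHom B = p.toHom B + q.toHom B := rfl

theorem toHom_zero : (0 : B.InnerHom M N).toHom B = 0 := rfl

/-- The action `(h p)(g ⊗ m) = p(g h ⊗ m)`. -/
instance : SMul H (B.InnerHom M N) where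
  smul h p := (p.toHom B).comp (B.rTensor (LinearMap.toSpanSingleton H H h))

theorem smul_tt (h : H) (p : B.InnerHom M N) (g : H) (m : M) :
    (h • p).toHom B (B.tt g m) = p.toHom B (B.tt (g * h) m) := rfl

instance : Module H (B.InnerHom M N) where
  one_smul p := ext fun g m => by rw [smul_tt, mul_one]
  mul_smul h h' p := ext fun g m => by rw [smul_tt, smul_tt, smul_tt, mul_assoc]
  smul_zero h := ext fun g m => rfl
  smul_add h p q := ext fun g m => rfl
  add_smul h h' p := ext fun g m => by
    rw [smul_tt, toHom_add, LinearMap.add_apply, smul_tt, smul_tt, mul_add, add_tt, map_add]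
  zero_smul p := ext fun g m => by
    rw [smul_tt, toHom_zero, LinearMap.zero_apply, mul_zero]
    exact (congrArg (p.toHom B) (BTensor.zero_tmul (M := B.toEnvRing.Res H)
      (N := B.toEnvRing.Res M) m)).trans (map_zero _)

variable (B M N)

/-- The additive map underlying the evaluation. -/
def evAdd : B.toEnvRing.Tens (B.InnerHom M N) M →+ N :=
  B.toEnvRing.lift
    (AddMonoidHom.mk' (fun p : B.InnerHom M N =>
        AddMonoidHom.mk' (fun m : M => p.toHom B (B.tt 1 m))
          (fun m m' => by rw [tt_add, map_add]))
      (fun p q => by ext m; rfl))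
    (fun r p m => by
      change p.toHom B (B.tt (1 * B.t (op r)) m) = p.toHom B (B.tt 1 (B.s r • m))
      rw [one_mul, ← B.tt_smul, smul_eq_mul, mul_one])

/-- For `w = Δ(h)` the left side is the evaluation at `h (p ⊗ m)` and the right side is `p(h (1 ⊗
m))`, so linearity of the evaluation reduces to linearity of `p`. -/
theorem evAdd_evalAt (p : B.InnerHom M N) (m : M) (w : B.toEnvRing.Tens H H) :
    evAdd B M N (B.toEnvRing.evalAt p m w) =
      p.toHom B (B.tensorEquiv H M (B.toEnvRing.evalAt 1 m w)) := by
  induction w using EnvRing.tens_induction with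
  | h0 => simp
  | ht a b =>
    rw [EnvRing.evalAt_tp, EnvRing.evalAt_tp, smul_eq_mul, mul_one]
    exact congrArg (fun c => p.toHom B (B.tt c (b • m))) (one_mul a)
  | ha x y hx hy => simp only [map_add, hx, hy]

/-- The evaluation `p ⊗ m ↦ p(1 ⊗ m)`. -/
def ev : B.Tensor (B.InnerHom M N) M →ₗ[H] N :=
  B.tensorLinear ((evAdd B M N).comp (B.tensorEquiv _ M).symm.toAddMonoidHom)
    (fun h p m => (evAdd_evalAt B M N p m (B.comul h)).trans
      (map_smul (p.toHom B) h (B.tt 1 m)))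

variable {M N}

variable {B}

/-- The `H`-linear map `X → Hom_H(H ⊗_R M, N)` that corresponds to `f : X ⊗_R M → N`. -/
def curry {X : Type*} [AddCommGroup X] [Module H X] (f : B.Tensor X M →ₗ[H] N) :
    X →ₗ[H] B.InnerHom M N where
  toFun x := f.comp (B.rTensor (LinearMap.toSpanSingleton H X x))
  map_add' x y := ext fun g m => by
    change f (B.tt (g • (x + y)) m) = f (B.tt (g • x) m) + f (B.tt (g • y) m)
    rw [smul_add, add_tt, map_add]
  map_smul' h x := ext fun g m => by
    change f (B.tt (g • h • x) m) = f (B.tt ((g * h) • x) m)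
    rw [mul_smul]

theorem curry_tt {X : Type*} [AddCommGroup X] [Module H X] (f : B.Tensor X M →ₗ[H] N) (x : X)
    (g : H) (m : M) : (curry f x).toHom B (B.tt g m) = f (B.tt (g • x) m) := rfl

end InnerHom

end InnerHom

/-! ### From preservation of inner homs to bijectivity of the Galois map. -/

section Hopf

variable {k : Type v} {R H : Type u} [CommRing k] [Ring R] [Algebra k R] [Ring H] [Algebra k H]
  (B : TimesBialgebra k R H) {M N : Type u} [AddCommGroup M] [Module H M] [AddCommGroup N]
  [Module H N]

/-- No Hopf condition is needed. Uniqueness holds because `H`-linearity forces `g(x)(a ⊗ m) = (a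
g(x))(1 ⊗ m) = g(a x)(1 ⊗ m) = f(a x ⊗ m)`. -/
theorem isRightInnerHom_ev : B.IsRightInnerHom (InnerHom.ev B M N) := by
  intro X _ _ f
  refine ⟨InnerHom.curry f, fun x m => ?_, fun g hg => ?_⟩
  · exact congrArg (fun y => f (B.tt y m)) (one_smul H x)
  · refine LinearMap.ext fun x => InnerHom.ext fun a m => ?_
    have h1 := hg (a • x) m
    rw [map_smul] at h1
    exact (congrArg (fun b => (g x).toHom B (B.tt b m)) (one_mul a).symm).trans h1

theorem algebraMap_smul_res (c : k) (x : B.toEnvRing.Res M) :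
    algebraMap k R c • x = op (algebraMap k R c) • x := by
  rw [EnvRing.res_smul, EnvRing.res_op_smul, AlgHom.commutes, ← MulOpposite.algebraMap_apply,
    AlgHom.commutes]

variable (M N) in
/-- The `R`-bimodule `Hom_{Rᵐᵒᵖ}(M, N)` of additive maps that commute with the target map. -/
def TargetHom : Type u := B.toEnvRing.Res M →ₗ[Rᵐᵒᵖ] B.toEnvRing.Res N

namespace TargetHom

instance : AddCommGroup (B.TargetHom M N) :=
  inferInstanceAs (AddCommGroup (B.toEnvRing.Res M →ₗ[Rᵐᵒᵖ] B.toEnvRing.Res N))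

variable {B}

/-- The underlying linear map. -/
def toHom (f : B.TargetHom M N) : B.toEnvRing.Res M →ₗ[Rᵐᵒᵖ] B.toEnvRing.Res N := f

theorem ext {f g : B.TargetHom M N} (h : ∀ m, f.toHom m = g.toHom m) : f = g := LinearMap.ext h

instance : Module R (B.TargetHom M N) :=
  haveI := SMulCommClass.symm R Rᵐᵒᵖ (B.toEnvRing.Res N)
  inferInstanceAs (Module R (B.toEnvRing.Res M →ₗ[Rᵐᵒᵖ] B.toEnvRing.Res N))

/-- The right action of `R` on `Hom_{Rᵐᵒᵖ}(M, N)`, by `(f r)(m) = f(s(r) m)`. -/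
instance : SMul Rᵐᵒᵖ (B.TargetHom M N) where
  smul r f :=
    haveI := SMulCommClass.symm R Rᵐᵒᵖ (B.toEnvRing.Res M)
    f.toHom.comp (Module.toModuleEnd Rᵐᵒᵖ (S := R) (B.toEnvRing.Res M) r.unop)

instance : Module Rᵐᵒᵖ (B.TargetHom M N) where
  one_smul f := ext fun m => congrArg f.toHom (one_smul R m)
  mul_smul r r' f := ext fun m => congrArg f.toHom (mul_smul r'.unop r.unop m)
  smul_zero _ := ext fun _ => rfl
  smul_add _ _ _ := ext fun _ => rfl
  add_smul r r' f := ext fun m => (congrArg f.toHom (add_smul r.unop r'.unop m)).trans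
    (map_add f.toHom _ _)
  zero_smul f := ext fun m => (congrArg f.toHom (zero_smul R m)).trans (map_zero f.toHom)

instance : SMulCommClass R Rᵐᵒᵖ (B.TargetHom M N) where
  smul_comm _ _ _ := rfl

variable (B M N)

/-- The evaluation `Hom_{Rᵐᵒᵖ}(M, N) ⊗_R M → N`. -/
def ev : BTensor R (B.TargetHom M N) (B.toEnvRing.Res M) →+ B.toEnvRing.Res N :=
  BTensor.lift (AddMonoidHom.mk' (fun f => f.toHom.toAddMonoidHom) (fun _ _ => rfl))
    (fun _ _ _ => rfl)

theorem isBimoduleHom_ev : IsBimoduleHom R (ev B M N) where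
  map_smul r z := by
    induction z using BTensor.induction_on with
    | h0 => simp
    | ht f m => rfl
    | ha x y hx hy => simp only [smul_add, map_add, hx, hy]
  map_op_smul r z := by
    induction z using BTensor.induction_on with
    | h0 => simp
    | ht f m => exact map_smul f.toHom r m
    | ha x y hx hy => simp only [smul_add, map_add, hx, hy]

variable {B M N}

/-- The universal property for bimodules only admits `k`-central test objects, and `Hom_{R̄}(M, N)`
must qualify. Centrality of `N`, then linearity of `f`, then centrality of `M` give `c f(m) = f(m) c
= f(m c) = f(c m)`. -/
theorem algebraMap_smul (c : k) (f : B.TargetHom M N) :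
    algebraMap k R c • f = op (algebraMap k R c) • f := ext fun m => by
  refine (B.algebraMap_smul_res c (f.toHom m)).trans ?_
  refine (map_smul f.toHom (op (algebraMap k R c)) m).symm.trans ?_
  exact congrArg f.toHom (B.algebraMap_smul_res c m).symm

end TargetHom

variable {B}

theorem isBimoduleHom_comp_tensorEquiv {P : Type u} [AddCommGroup P] [Module H P]
    (ev : B.Tensor P M →ₗ[H] N) : IsBimoduleHom R (M := B.toEnvRing.Tens P M)
      (N := B.toEnvRing.Res N) (ev.toAddMonoidHom.comp (B.tensorEquiv P M).toAddMonoidHom) where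
  map_smul r z := (congrArg ev (B.tensorEquiv_smul r z)).trans (map_smul ev _ _)
  map_op_smul r z := (congrArg ev (B.tensorEquiv_op_smul r z)).trans (map_smul ev _ _)

/-- The Hopf condition makes `Hom_H(H ⊗_R M, N)` a right inner hom of bimodules, hence in bijection
with `Hom_{R̄}(M, N)` through restriction along `m ↦ 1 ⊗ m`. -/
theorem IsHopf.existsUnique_extension (hB : B.IsHopf) (f : M →+ N)
    (hf : ∀ r m, f (B.t r • m) = B.t r • f m) :
    ∃! F : B.Tensor H M →ₗ[H] N, ∀ m, F (B.tt 1 m) = f m := by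
  have hP := hB M N (B.InnerHom M N) (InnerHom.ev B M N) B.isRightInnerHom_ev
  -- Testing against `Hom_{R̄}(M, N)` with its evaluation produces an extension operator `g`: the
  -- property `hg'` says that `g f` restricts to `f`.
  obtain ⟨g, ⟨hg, hg'⟩, -⟩ := hP.2 (B.TargetHom M N) TargetHom.algebraMap_smul (TargetHom.ev B M N)
    (TargetHom.isBimoduleHom_ev B M N)
  let f' : B.TargetHom M N := (⟨⟨f, f.map_add⟩, hf⟩ : B.toEnvRing.Res M →ₗ[Rᵐᵒᵖ] B.toEnvRing.Res N)
  refine ⟨(g f' : B.InnerHom M N), fun m => hg' f' m, fun F hF => ?_⟩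
  -- Restriction along `m ↦ 1 ⊗ m`. Uniqueness of extensions follows once `g ∘ res` is the identity.
  let res : B.toEnvRing.Res (B.InnerHom M N) →+ B.TargetHom M N := AddMonoidHom.mk'
    (fun p : B.InnerHom M N => (⟨⟨fun m : M => p.toHom B (B.tt 1 m), fun m m' =>
      (congrArg (p.toHom B) (B.tt_add 1 m m')).trans (map_add _ _ _)⟩, fun r m =>
      (congrArg (p.toHom B) (B.t_smul_tt r 1 m).symm).trans (map_smul (p.toHom B) _ _)⟩ :
        B.toEnvRing.Res M →ₗ[Rᵐᵒᵖ] B.toEnvRing.Res N))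
    (fun p q => rfl)
  have hres : IsBimoduleHom R res :=
    { map_smul := fun r p => TargetHom.ext fun (m : M) => by
        change InnerHom.toHom B p (B.tt (1 * B.s r) m) = B.s r • InnerHom.toHom B p (B.tt 1 m)
        rw [← map_smul, s_smul_tt, one_mul, smul_eq_mul, mul_one]
      map_op_smul := fun r p => TargetHom.ext fun (m : M) => by
        change InnerHom.toHom B p (B.tt (1 * B.t r) m) =
          InnerHom.toHom B p (B.tt 1 (B.s r.unop • m))
        rw [← B.tt_smul, one_mul, smul_eq_mul, mul_one, op_unop] }
  -- Both `g ∘ res` and the identity correspond to the evaluation of the inner hom itself, so the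
  -- universal property identifies them.
  have huniq := (hP.2 (B.toEnvRing.Res (B.InnerHom M N)) B.algebraMap_smul_res _ hP.1).unique
    (y₁ := g.comp res) (y₂ := AddMonoidHom.id _)
    ⟨⟨fun r p => (congrArg g (hres.map_smul r p)).trans (hg.map_smul _ _),
      fun r p => (congrArg g (hres.map_op_smul r p)).trans (hg.map_op_smul _ _)⟩,
      fun p m => hg' (res p) m⟩
    ⟨⟨fun _ _ => rfl, fun _ _ => rfl⟩, fun _ _ => rfl⟩
  have h1 : res F = f' := TargetHom.ext hF
  exact (DFunLike.congr_fun huniq F).symm.trans (congrArg g h1)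

/-- The modules `H ⊗_{R̄} H` and `H ⊗_R H` both represent `R̄`-linear maps out of `H`, through `m ↦
1 ⊗ m`, and the Galois map respects these universal maps. -/
theorem IsHopf.bijective_galois (hB : B.IsHopf) : Function.Bijective (B.galois H) := by
  -- The inverse is the extension of `m ↦ 1 ⊗ m`, now viewed as a map into the induced module.
  obtain ⟨F, hF, -⟩ := hB.existsUnique_extension (M := H) (N := B.toEnvRing.Ind H)
    (B.toEnvRing.itpHom 1) (fun r h => by
      change B.toEnvRing.itp 1 (B.t r • h) = B.t r • B.toEnvRing.itp 1 h
      rw [← EnvRing.itp_t, EnvRing.smul_itp, one_mul, mul_one])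
  have h1 : F.comp (B.galois H) = LinearMap.id := B.toEnvRing.ind_hom_ext fun m => by
    rw [LinearMap.comp_apply, galois_itp, one_smul, hF]
    rfl
  have h2 : (B.galois H).comp F = LinearMap.id :=
    (hB.existsUnique_extension (M := H) (N := B.Tensor H H)
      (AddMonoidHom.mk' (fun m => B.tt (1 : H) m) (B.tt_add 1))
      (fun r m => (B.t_smul_tt r 1 m).symm)).unique
      (fun m => by
        rw [LinearMap.comp_apply, hF]
        exact (B.galois_itp 1 m).trans (one_smul _ _))
      (fun m => rfl)
  exact ⟨Function.LeftInverse.injective fun z => LinearMap.congr_fun h1 z,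
    Function.RightInverse.surjective fun z => LinearMap.congr_fun h2 z⟩

end Hopf

end TimesBialgebra

/-! ### From a bijective Galois map back to preservation of inner homs. -/

theorem EnvRing.evalAt_one_one {k R H : Type*} [CommRing k] [Ring R] [Algebra k R] [Ring H]
    [Algebra k H] (E : EnvRing k R H) (w : E.Tens H H) : E.evalAt (1 : H) (1 : H) w = w := by
  induction w using EnvRing.tens_induction with
  | h0 => simp
  | ht a b => simp
  | ha x y hx hy => simp only [map_add, hx, hy]

namespace TimesBialgebra

section GaloisInverse

variable {k R H : Type*} [CommRing k] [Ring R] [Algebra k R] [Ring H] [Algebra k H]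
  {B : TimesBialgebra k R H} {M N : Type*} [AddCommGroup M] [Module H M] [AddCommGroup N]
  [Module H N]

/-- The Galois map is bijective for every module if it is bijective for `H`. -/
theorem bijective_galois_module (hB : Function.Bijective (B.galois H)) (M : Type*)
    [AddCommGroup M] [Module H M] : Function.Bijective (B.galois M) := by
  let e := LinearEquiv.ofBijective (B.galois H) hB
  -- The map `β_H` commutes with right multiplication on the second factor, so its inverse is
  -- determined by the values at `g ⊗ 1`.
  have he : ∀ g h, e.symm (B.tt g h) = B.indMulRight h (e.symm (B.tt g 1)) := fun g h => by
    rw [LinearEquiv.symm_apply_eq]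
    change _ = B.galois H (B.indMulRight h (e.symm (B.tt g 1)))
    rw [galois_indMulRight]
    change _ = B.tensorEquiv H H (B.toEnvRing.evalAt 1 h ((B.tensorEquiv H H).symm
      (e (e.symm (B.tt g 1)))))
    rw [e.apply_symm_apply]
    change B.tt g h = B.tt (g • (1 : H)) ((1 : H) • h)
    rw [smul_eq_mul, mul_one, one_smul]
  -- The inverse of `β_M` is `g ⊗ m ↦ β_H⁻¹(g ⊗ 1) m`. It is balanced because `t(r) g ⊗ 1 = g ⊗
  -- s(r)`, and by `he` the inverse image of the latter is `β_H⁻¹(g ⊗ 1) s(r)`.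
  let inv : B.toEnvRing.Tens H M →+ B.toEnvRing.Ind M := B.toEnvRing.lift
    (AddMonoidHom.mk' (fun g => AddMonoidHom.mk' (fun m => B.indMulRight m (e.symm (B.tt g 1)))
        (fun m m' => by
          generalize e.symm (B.tt g 1) = z
          induction z using EnvRing.ind_induction with
          | h0 => simp
          | ht a b => simp only [indMulRight_itp, smul_add, EnvRing.itp_add]
          | ha x y hx hy => simp only [map_add, hx, hy]; abel))
      (fun g g' => by ext m; simp [add_tt]))
    (fun r g m => by
      change B.indMulRight m (e.symm (B.tt (B.t (op r) • g) 1)) =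
        B.indMulRight (B.s r • m) (e.symm (B.tt g 1))
      rw [B.tt_smul, he, indMulRight_indMulRight, smul_eq_mul, mul_one])
  have hinv : ∀ m w, inv (B.toEnvRing.evalAt 1 m w) =
      B.indMulRight m (e.symm (B.tensorEquiv H H w)) := fun m w => by
    induction w using EnvRing.tens_induction with
    | h0 => simp
    | ht a b =>
      change B.indMulRight (b • m) (e.symm (B.tt (a • (1 : H)) 1)) =
        B.indMulRight m (e.symm (B.tt a b))
      rw [he a b, indMulRight_indMulRight, smul_eq_mul, mul_one]
    | ha x y hx hy => simp only [map_add, hx, hy]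
  refine ⟨Function.LeftInverse.injective (g := inv) fun z => ?_,
    Function.RightInverse.surjective (g := inv) fun z => ?_⟩
  · induction z using EnvRing.ind_induction with
    | h0 => exact (congrArg inv (map_zero _)).trans (map_zero _)
    | ht h m =>
      -- Since `Δ(h) = β_H(h ⊗ 1)`, the formula `hinv` recovers `h ⊗ m` from `β_M(h ⊗ m) = ∑ h₁ ⊗ h₂
      -- m`.
      have h1 : B.tensorEquiv H H (B.comul h) = e (B.toEnvRing.itp h 1) :=
        congrArg (B.tensorEquiv H H) (B.toEnvRing.evalAt_one_one (B.comul h)).symm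
      refine (hinv m (B.comul h)).trans ?_
      rw [h1, e.symm_apply_apply, indMulRight_itp, one_smul]
    | ha x y hx hy =>
      exact (congrArg inv (map_add _ x y)).trans ((map_add inv _ _).trans (congrArg₂ _ hx hy))
  · induction z using tt_induction with
    | h0 => exact (congrArg _ (map_zero inv)).trans (map_zero _)
    | ht g m =>
      change B.galois M (B.indMulRight m (e.symm (B.tt g 1))) = _
      rw [galois_indMulRight]
      change B.tensorEquiv H M (B.toEnvRing.evalAt 1 m ((B.tensorEquiv H H).symm
        (e (e.symm (B.tt g 1))))) = _
      rw [e.apply_symm_apply]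
      change B.tt (g • (1 : H)) ((1 : H) • m) = _
      rw [smul_eq_mul, mul_one, one_smul]
    | ha x y hx hy =>
      exact (congrArg _ (map_add inv x y)).trans ((map_add _ _ _).trans (congrArg₂ _ hx hy))

/-- The extension property always holds for the induced module `H ⊗_{R̄} M`; bijectivity of `β_M`
carries it over to `H ⊗_R M`. -/
theorem existsUnique_extension_of_bijective_galois (hB : Function.Bijective (B.galois H))
    (f : M →+ N) (hf : ∀ r m, f (B.t r • m) = B.t r • f m) :
    ∃! F : B.Tensor H M →ₗ[H] N, ∀ m, F (B.tt 1 m) = f m := by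
  let e := LinearEquiv.ofBijective (B.galois M) (bijective_galois_module hB M)
  have he : ∀ m, e (B.toEnvRing.itp 1 m) = B.tt 1 m := fun m =>
    (B.galois_itp 1 m).trans (one_smul _ _)
  refine ⟨(B.toEnvRing.indLift f hf).comp e.symm.toLinearMap, fun m => ?_, fun F hF => ?_⟩
  · rw [← he, LinearMap.comp_apply]
    change B.toEnvRing.indLift f hf (e.symm (e _)) = _
    rw [e.symm_apply_apply, EnvRing.indLift_itp, one_smul]
  · have h1 : F.comp e.toLinearMap = B.toEnvRing.indLift f hf :=
      B.toEnvRing.ind_hom_ext fun m => by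
        rw [EnvRing.indLift_itp, one_smul, ← hF, ← he]; rfl
    ext z
    rw [← h1]
    exact congrArg F (e.apply_symm_apply z).symm

end GaloisInverse

section Hopf

variable {k : Type v} {R H : Type u} [CommRing k] [Ring R] [Algebra k R] [Ring H] [Algebra k H]
  {B : TimesBialgebra k R H}

/-- An arbitrary inner hom `P` is compared with the model `Hom_H(H ⊗_R M, N)`. By the extension
property an element of the model is the same as an `R̄`-linear map `M → N`, so a bimodule map `X ⊗_R
M → N` determines a map `X → P` pointwise. -/
theorem isHopf_of_bijective_galois (hB : Function.Bijective (B.galois H)) : B.IsHopf := by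
  intro M N P _ _ _ _ _ _ ev hev
  refine ⟨isBimoduleHom_comp_tensorEquiv ev, fun X _ _ _ _ _ f hf => ?_⟩
  -- The universal property of `P`, tested on the model, gives the comparison map `Φ`. Below only
  -- the identity `Φ ∘ curry ev = id` is needed, not that `Φ` is invertible.
  obtain ⟨Φ, hΦ, -⟩ := hev (B.InnerHom M N) (InnerHom.ev B M N)
  have hΦ' : ∀ (p : B.InnerHom M N) m, ev (B.tt (Φ p) m) = p.toHom B (B.tt 1 m) := hΦ
  have hev_eq : ∀ p, Φ (InnerHom.curry ev p) = p := fun p =>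
    LinearMap.congr_fun ((hev P ev).unique (y₁ := Φ.comp (InnerHom.curry ev))
      (y₂ := LinearMap.id)
      (fun x m => (hΦ' _ m).trans ((InnerHom.curry_tt ev x 1 m).trans (by rw [one_smul]; rfl)))
      (fun x m => rfl)) p
  -- Elements of `P` are separated by `ev(- ⊗ m)`: the extension property makes their images in the
  -- model equal, and `Φ` takes these back to `p` and `q`. Additivity, bilinearity and uniqueness of
  -- the map `X → P` all follow from this.
  have hsep : ∀ p q : P, (∀ m, ev (B.tt p m) = ev (B.tt q m)) → p = q := fun p q h => by
    rw [← hev_eq p, ← hev_eq q]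
    refine congrArg Φ ((existsUnique_extension_of_bijective_galois hB
      (AddMonoidHom.mk' (fun m => ev (B.tt q m)) (fun m m' => by rw [tt_add, map_add]))
      (fun r m => by
        change ev (B.tt q (B.t r • m)) = B.t r • ev (B.tt q m)
        rw [← t_smul_tt, map_smul])).unique (fun m => ?_) (fun m => ?_))
    · exact (InnerHom.curry_tt ev p 1 m).trans ((by rw [one_smul] :
        ev (B.tt ((1 : H) • p) m) = ev (B.tt p m)).trans (h m))
    · exact (InnerHom.curry_tt ev q 1 m).trans (by rw [one_smul]; rfl)
  -- The map `m ↦ f(x ⊗ m)` is `R̄`-linear, so it extends to an element `F` of the model, and `Φ F`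
  -- is the required element of `P`.
  have hex : ∀ x : X, ∃ p : P, ∀ m : M,
      ev (B.tt p m) = f (BTensor.tmul R (N := B.toEnvRing.Res M) x m) := fun x => by
    obtain ⟨F, hF, -⟩ := existsUnique_extension_of_bijective_galois hB (M := M) (N := N)
      (f.comp (BTensor.tmulHom (R := R) (N := B.toEnvRing.Res M) x)) (fun r m =>
        hf.map_op_smul r (BTensor.tmul R (N := B.toEnvRing.Res M) x m))
    exact ⟨Φ F, fun m => (hΦ' F m).trans (hF m)⟩
  choose g hg using hex
  let g' : X →+ P := AddMonoidHom.mk' g fun x y => hsep _ _ fun m => by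
    rw [add_tt, map_add, hg, hg, hg]
    exact (congrArg f (BTensor.add_tmul (N := B.toEnvRing.Res M) x y m)).trans (map_add f _ _)
  refine ⟨g', ⟨⟨fun r x => hsep _ _ fun m => ?_, fun r x => hsep _ _ fun m => ?_⟩,
    fun x m => hg x m⟩, fun q hq => ?_⟩
  · refine (hg _ m).trans ((hf.map_smul r
      (BTensor.tmul R (N := B.toEnvRing.Res M) x m)).trans ?_)
    refine (congrArg (B.s r • ·) (hg x m).symm).trans ?_
    refine (map_smul ev (B.s r) (B.tt (g x) m)).symm.trans ?_
    exact congrArg ev (B.s_smul_tt r (g x) m)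
  · refine (hg _ m).trans ((congrArg f (BTensor.smul_tmul (N := B.toEnvRing.Res M)
      r.unop x m)).trans ((hg x (B.s r.unop • m)).symm.trans ?_))
    exact congrArg ev (B.tt_smul r.unop (g x) m).symm
  · exact AddMonoidHom.ext fun x => hsep _ _ fun m => (hq.2 x m).trans (hg x m).symm

end Hopf

end TimesBialgebra

/-! ### Invertibility of the interchange of tensor factors. -/

namespace EnvRing

section Unswap

variable {k R H : Type*} [CommRing k] [Ring R] [Algebra k R] [Ring H] [Algebra k H]
  (E : EnvRing k R H) {M N : Type*} [AddCommGroup M] [Module H M] [AddCommGroup N] [Module H N]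

/-- The inverse of the interchange of tensor factors. -/
def unswap : E.coop.Tens N M →+ E.Tens M N :=
  E.coop.lift
    (AddMonoidHom.mk' (fun n => AddMonoidHom.mk' (fun m => E.tp m n)
        (fun m m' => E.add_tp m m' n))
      (fun n n' => by ext m; exact E.tp_add m n n'))
    (fun r n m => (E.tp_smul r.unop m n).symm)

theorem unswap_swap (z : E.Tens M N) : E.unswap (E.swap z) = z := by
  induction z using tens_induction with
  | h0 => simp
  | ht m n => rfl
  | ha x y hx hy => simp only [map_add, hx, hy]

theorem swap_unswap (z : E.coop.Tens N M) : E.swap (E.unswap z) = z := by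
  induction z using tens_induction with
  | h0 => simp
  | ht m n => rfl
  | ha x y hx hy => simp only [map_add, hx, hy]

end Unswap

end EnvRing

/-! ### The Galois map of the dual as the transpose of the Galois map. -/

namespace TimesBialgebra

section DualGalois

variable {k R H : Type*} [CommRing k] [Ring R] [Algebra k R] [Ring H] [Algebra k H]
  (B : TimesBialgebra k R H)

/-- Both sides send `g ⊗ h` to `φ(s(r ψ(g)) h)`. This is the balancing that lets `conv` descend to
the module induced along the source map. -/
theorem conv_mul_source (φ ψ : B.SkewDual) (r : R) (z : B.toEnvRing.Tens H H) :
    SkewDual.conv (φ * SkewDual.source r) ψ z = SkewDual.conv φ (SkewDual.source r * ψ) z := by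
  induction z using EnvRing.tens_induction with
  | h0 => simp
  | ht g h =>
    rw [SkewDual.conv_tp, SkewDual.conv_tp, SkewDual.mul_source_apply,
      SkewDual.source_mul_apply, map_mul B.s, mul_assoc]
  | ha x y hx hy => simp only [map_add, hx, hy]

/-- The map that sends `φ ⊗ ψ` in the module induced along the source map of the skew dual to the
functional `g ⊗ h ↦ φ(s(ψ(g)) h)` on `H ⊗_R H`. -/
def convInd : B.dualEnvRing.coop.Ind B.SkewDual →+ B.toEnvRing.Tens H H →+ R :=
  B.dualEnvRing.coop.indLiftAdd
    (AddMonoidHom.mk' (fun φ => AddMonoidHom.mk' (fun ψ => SkewDual.conv φ ψ)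
        (fun ψ ψ' => by ext z; exact SkewDual.conv_add_right φ ψ ψ' z))
      (fun φ φ' => by ext ψ z; exact SkewDual.conv_add_left φ φ' ψ z))
    (fun φ r ψ => by ext z; exact B.conv_mul_source φ ψ r.unop.unop z)

theorem convInd_itp (φ ψ : B.SkewDual) :
    B.convInd (B.dualEnvRing.coop.itp φ ψ) = SkewDual.conv φ ψ := rfl

theorem itp_mul_source (φ ψ : B.SkewDual) (r : R) :
    B.dualEnvRing.coop.itp (φ * SkewDual.source r) ψ =
      B.dualEnvRing.coop.itp φ (SkewDual.source r * ψ) :=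
  -- The coopposite has base `Rᵐᵒᵖ`, and its target map is the source map of the skew dual, indexed
  -- by the double opposite of `R`.
  B.dualEnvRing.coop.itp_t φ (op (op r)) ψ

/-- For `g` in `H`, the map `φ ⊗ ψ ↦ φ s(ψ(g))`, that is, `h ↦ φ(s(ψ(g)) h)`. -/
def sliceInd (g : H) : B.dualEnvRing.coop.Ind B.SkewDual →+ B.SkewDual :=
  B.dualEnvRing.coop.indLiftAdd
    (AddMonoidHom.mk' (fun φ => AddMonoidHom.mk'
        (fun ψ : B.SkewDual => φ * SkewDual.sourceHom (ψ g))
        (fun ψ ψ' => by rw [SkewDual.add_apply, map_add, mul_add]))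
      (fun φ φ' => by ext1 ψ; exact add_mul _ _ _))
    (fun φ r ψ => by
      change φ * SkewDual.source r.unop.unop * SkewDual.sourceHom (ψ g) =
        φ * SkewDual.sourceHom ((SkewDual.source r.unop.unop * ψ : B.SkewDual) g)
      rw [SkewDual.source_mul_apply, map_mul, mul_assoc]
      rfl)

theorem sliceInd_itp (g : H) (φ ψ : B.SkewDual) :
    B.sliceInd g (B.dualEnvRing.coop.itp φ ψ) = φ * SkewDual.source (ψ g) := rfl

/-- Slices are partial evaluations of the functional `convInd x`, so they all vanish when it does.
-/
theorem sliceInd_apply (g h : H) (x : B.dualEnvRing.coop.Ind B.SkewDual) :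
    B.sliceInd g x h = B.convInd x (B.toEnvRing.tp g h) := by
  induction x using EnvRing.ind_induction with
  | h0 => simp
  | ht φ ψ => rw [sliceInd_itp, SkewDual.mul_source_apply, convInd_itp, SkewDual.conv_tp]
  | ha x y hx hy => simp only [map_add, SkewDual.add_apply, AddMonoidHom.add_apply, hx, hy]

variable {B}

/-- A dual basis `(bᵢ, cᵢ)` reconstructs an element from its slices at the `bᵢ`, and the slices
depend only on its image under `convInd`. -/
theorem LeftFinite.convInd_injective (hB : B.LeftFinite) : Function.Injective B.convInd := by
  rw [injective_iff_map_eq_zero]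
  intro x hx
  obtain ⟨n, b, c, hbc⟩ := hB.exists_dualBasis
  have h1 : ∀ y : B.dualEnvRing.coop.Ind B.SkewDual,
      ∑ i, B.dualEnvRing.coop.itp (B.sliceInd (b i) y) (c i) = y := by
    intro y
    induction y using EnvRing.ind_induction with
    | h0 => simp only [map_zero, EnvRing.zero_itp, Finset.sum_const_zero]
    | ht φ ψ =>
      -- The dual basis expansion `h = ∑ t(cᵢ(h)) bᵢ`, read on functionals; the coefficients
      -- `s(ψ(bᵢ))` then move across the tensor sign.
      have h2 : ∑ i, SkewDual.source (ψ (b i)) * c i = ψ := by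
        refine SkewDual.ext fun g => ?_
        rw [SkewDual.sum_apply]
        conv_rhs => rw [← hbc g, map_sum]
        exact Finset.sum_congr rfl fun i _ => by
          rw [SkewDual.source_mul_apply, SkewDual.map_t_mul]
      conv_rhs => rw [← h2, EnvRing.itp_sum]
      exact Finset.sum_congr rfl fun i _ => by rw [sliceInd_itp, itp_mul_source]
    | ha y z hy hz =>
      simp only [map_add, EnvRing.add_itp, Finset.sum_add_distrib, hy, hz]
  rw [← h1 x]
  refine Finset.sum_eq_zero fun i _ => ?_
  rw [(SkewDual.ext fun h => by rw [sliceInd_apply, hx]; rfl : B.sliceInd (b i) x = 0),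
    EnvRing.zero_itp]

/-- This is surjectivity onto the `R̄`-linear functionals, where `R̄` acts on the second factor
through `t`. -/
theorem LeftFinite.exists_convInd_eq (hB : B.LeftFinite) (Φ : B.toEnvRing.Tens H H →+ R)
    (hΦ : ∀ (r : R) z, Φ (op r • z) = Φ z * r) : ∃ x, B.convInd x = Φ := by
  obtain ⟨n, b, c, hbc⟩ := hB.exists_dualBasis
  -- The witness is `∑ Φ(bᵢ ⊗ -) ⊗ cᵢ`. At `g ⊗ h` it gives `∑ Φ(bᵢ ⊗ s(cᵢ(g)) h) = ∑ Φ(t(cᵢ(g)) bᵢ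
  -- ⊗ h) = Φ(g ⊗ h)`. The hypothesis on `Φ` puts each `Φ(bᵢ ⊗ -)` in the skew dual.
  refine ⟨∑ i, B.dualEnvRing.coop.itp (SkewDual.mk (AddMonoidHom.mk'
    (fun h => Φ (B.toEnvRing.tp (b i) h)) (fun h h' => by rw [EnvRing.tp_add, map_add]))
    (fun r h => hΦ r (B.toEnvRing.tp (b i) h))) (c i), ?_⟩
  ext z
  induction z using EnvRing.tens_induction with
  | h0 => simp
  | ht g h =>
    rw [map_sum, AddMonoidHom.finsetSum_apply]
    have h1 : ∑ i, B.toEnvRing.tp (B.t (op (c i g)) * b i) h = B.toEnvRing.tp g h := by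
      conv_rhs => rw [← hbc g]
      exact (map_sum (AddMonoidHom.mk' (fun a : H => B.toEnvRing.tp a h)
        (fun a a' => B.toEnvRing.add_tp a a' h)) _ _).symm
    conv_rhs => rw [← h1, map_sum]
    refine Finset.sum_congr rfl fun i _ => ?_
    exact congrArg Φ (B.toEnvRing.tp_smul (c i g) (b i) h).symm
  | ha x y hx hy => simp only [map_add, hx, hy]

/-- The Galois map `φ ⊗ ψ ↦ ∑ φ₁ ψ ⊗ φ₂` of the coopposite of the skew dual, with values in
`H^∨ ⊗_R H^∨`. -/
noncomputable def dualGalois (hB : B.LeftFinite) :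
    B.dualEnvRing.coop.Ind B.SkewDual →+ B.dualEnvRing.Tens B.SkewDual B.SkewDual :=
  B.dualEnvRing.unswap.comp ((B.skewDual hB).coop.galois B.SkewDual).toAddMonoidHom

theorem dualGalois_itp (hB : B.LeftFinite) (φ ψ : B.SkewDual) :
    dualGalois hB (B.dualEnvRing.coop.itp φ ψ) =
      B.dualEnvRing.evalAt ψ (1 : B.SkewDual) (dualComul hB φ) := by
  refine Eq.trans ?_ (B.dualEnvRing.unswap_swap _)
  rw [EnvRing.swap_evalAt]
  rfl

/-- The transposition formula. Contracting `∑ φ₁ ψ ⊗ φ₂` with `h` leaves `(h φ) ψ`, because `∑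
t(φ₂(h)) φ₁ = h φ` defines the comultiplication; its value at `g` is `∑ φ(s(ψ(g₁)) g₂ h)`, the
functional of `φ ⊗ ψ` at `β(g ⊗ h)`. -/
theorem evDual_dualGalois (hB : B.LeftFinite) (x : B.dualEnvRing.coop.Ind B.SkewDual)
    (g h : H) :
    B.evDual h (dualGalois hB x) g = B.convInd x (B.galois H (B.toEnvRing.itp g h)) := by
  induction x using EnvRing.ind_induction with
  | h0 =>
    rw [map_zero, map_zero, map_zero]
    rfl
  | ht φ ψ =>
    rw [dualGalois_itp, evDual_evalAt_left, evDual_dualComul]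
    change _ = SkewDual.conv φ ψ (B.toEnvRing.evalAt 1 h (B.comul g))
    rw [conv_evalAt, SkewDual.mul_apply,
      (SkewDual.ext fun y => by rw [translate_apply, mul_one] : B.translate 1 ψ = ψ)]
  | ha x y hx hy =>
    rw [map_add, map_add, SkewDual.add_apply, map_add, hx, hy]
    rfl

theorem evDual_add (h h' : H) (w : B.dualEnvRing.Tens B.SkewDual B.SkewDual) :
    B.evDual (h + h') w = B.evDual h w + B.evDual h' w := by
  induction w using EnvRing.tens_induction with
  | h0 => simp
  | ht φ ψ =>
    refine SkewDual.ext fun g => ?_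
    simp only [evDual_tp, SkewDual.add_apply, SkewDual.target_mul_apply, map_add, op_add, mul_add]
  | ha x y hx hy => simp only [map_add, hx, hy]; abel

/-- On `φ ⊗ ψ` both sides are `φ(g t(r) t(ψ(h)))`, since `ψ(t(r) h) = ψ(h) r` and `t` reverses
products. Hence `(g, h) ↦ evDual h w g` is balanced over `R̄` and defines a functional on `H ⊗_{R̄}
H`. -/
theorem evDual_t_mul (r : R) (g h : H) (w : B.dualEnvRing.Tens B.SkewDual B.SkewDual) :
    B.evDual (B.t (op r) * h) w g = B.evDual h w (g * B.t (op r)) := by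
  induction w using EnvRing.tens_induction with
  | h0 => simp
  | ht φ ψ =>
    rw [evDual_tp, evDual_tp, SkewDual.target_mul_apply, SkewDual.target_mul_apply,
      SkewDual.map_t_mul, op_mul, map_mul B.t, mul_assoc]
  | ha x y hx hy => simp only [map_add, SkewDual.add_apply, hx, hy]

/-- By the transposition formula, surjectivity of `β` gives injectivity of its transpose, and an
inverse of `β` pulls functionals back. -/
theorem bijective_dualGalois (hB : B.LeftFinite) (hG : Function.Bijective (B.galois H)) :
    Function.Bijective (dualGalois hB) := by
  constructor
  · rw [injective_iff_map_eq_zero]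
    intro x hx
    refine (injective_iff_map_eq_zero B.convInd).1 hB.convInd_injective x ?_
    have h1 : ∀ y, B.convInd x (B.galois H y) = 0 := fun y => by
      induction y using EnvRing.ind_induction with
      | h0 => exact (congrArg (B.convInd x) (map_zero (B.galois H))).trans (map_zero _)
      | ht g h =>
        rw [← evDual_dualGalois hB, hx, map_zero]
        rfl
      | ha y z hy hz =>
        refine (congrArg (B.convInd x) (map_add (B.galois H) y z)).trans ?_
        exact (map_add (B.convInd x) _ _).trans ((congrArg₂ _ hy hz).trans (add_zero _))
    ext z
    obtain ⟨y, rfl⟩ := hG.2 z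
    exact h1 y
  · intro w
    let e := LinearEquiv.ofBijective (B.galois H) hG
    -- The functional `g ⊗ h ↦ ∑ φ(g t(ψ(h)))` attached to `w = ∑ φ ⊗ ψ`. A preimage of `w` is an
    -- element representing the composite of `Ψ` with `β⁻¹`.
    let Ψ : B.toEnvRing.Ind H →+ R := B.toEnvRing.indLiftAdd
      (AddMonoidHom.mk' (fun g => AddMonoidHom.mk' (fun h => B.evDual h w g)
          (fun h h' => by rw [evDual_add, SkewDual.add_apply]))
        (fun g g' => by ext h; exact map_add (B.evDual h w) g g'))
      (fun g r h => (evDual_t_mul r.unop g h w).symm)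
    -- Only `R̄`-linear functionals on `H ⊗_R H` are representable. Linearity of `Ψ` passes to its
    -- composite with `β⁻¹` because `β` is `H`-linear.
    have hΨ : ∀ (r : R) y, Ψ (B.t (op r) • y) = Ψ y * r := fun r y => by
      induction y using EnvRing.ind_induction with
      | h0 => simp
      | ht g h =>
        rw [EnvRing.smul_itp]
        exact SkewDual.map_t_mul (B.evDual h w) r g
      | ha x y hx hy => rw [smul_add, map_add, map_add, hx, hy, add_mul]
    let Φ : B.toEnvRing.Tens H H →+ R :=
      Ψ.comp ((e.symm : B.Tensor H H →+ _).comp (B.tensorEquiv H H).toAddMonoidHom)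
    obtain ⟨x, hx⟩ := hB.exists_convInd_eq Φ fun r y =>
      (congrArg (fun a => Ψ (e.symm a)) (B.tensorEquiv_op_smul (op r) y)).trans
        ((congrArg Ψ (map_smul e.symm _ _)).trans (hΨ r _))
    refine ⟨x, evDual_injective hB fun h => SkewDual.ext fun g => ?_⟩
    rw [evDual_dualGalois, hx]
    exact congrArg Ψ (e.symm_apply_apply (B.toEnvRing.itp g h))

/-- If the Galois map of a left finite `×_R`-bialgebra is bijective, then so is the Galois map of
the coopposite of its skew dual. -/
theorem bijective_galois_coop_skewDual (hB : B.LeftFinite)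
    (hG : Function.Bijective (B.galois H)) :
    Function.Bijective ((B.skewDual hB).coop.galois B.SkewDual) :=
  (Function.Bijective.of_comp_iff' (f := B.dualEnvRing.unswap (M := B.SkewDual) (N := B.SkewDual))
    ⟨Function.LeftInverse.injective (g := B.dualEnvRing.swap) B.dualEnvRing.swap_unswap,
      Function.RightInverse.surjective (g := B.dualEnvRing.swap) B.dualEnvRing.unswap_swap⟩ _).1
    (bijective_dualGalois hB hG)

end DualGalois

end TimesBialgebra

theorem mainTheorem1 {k : Type v} {R H : Type u} [CommRing k] [Ring R] [Algebra k R] [Ring H]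
    [Algebra k H] (B : TimesBialgebra k R H) (hfin : B.LeftFinite) (hHopf : B.IsHopf) :
    (B.skewDual hfin).IsAntiHopf :=
  TimesBialgebra.isHopf_of_bijective_galois
    (TimesBialgebra.bijective_galois_coop_skewDual hfin hHopf.bijective_galois)
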